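/- Let $\mathcal B$ be a unital $C^*$-algebra, $\mathcal C$ a von Neumann algebra acting on a Hilbert space $H$, $\Omega$ a set, and $\alpha$ a $*$-automorphism of $\mathcal B$. **Kernels.** A kernel $\mathfrak K=(\mathfrak K^{\sigma,\sigma'})_{\sigma,\sigma'\in\Omega}$ of bounded linear maps $\mathcal B\to\mathcal C$ is an $\alpha$-CPD-kernel if $\mathfrak K^{\sigma,\sigma'}(b^*)=\mathfrak K^{\sigma',\sigma}(b)^*$, $\mathfrak K^{\sigma,\sigma'}(\alpha(b))=\mathfrak K^{\sigma,\sigma'}(b)$, $\sum_{i,j}c_i^*\mathfrak K^{\sigma_i,\sigma_j}(\alpha(b_i)^*b_j)c_j\ge 0$ for all finite families $\sigma_i\in\Omega$, $b_i\in\mathcal B$, $c_i\in\mathcal C$, and for each $b\in\mathcal B$ there is $M(b)>0$ with $\|\sum_{i,j}c_i^*\mathfrak K^{\sigma_i,\sigma_j}(\alpha(b_i^*b^*)bb_j)c_j\|\le M(b)\|\sum_{i,j}c_i^*\mathfrak K^{\sigma_i,\sigma_j}(\alpha(b_i^*)b_j)c_j\|$ for all such families. **S-correspondences.** An S-correspondence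 from $\mathcal B$ to $\mathcal C$ is a (right) Hilbert $\mathcal C$-module $\mathcal F$, with inner product linear in the second variable, together with a unitary $U$ on $\mathcal F$ and a unital algebra homomorphism $\pi$ of $\mathcal B$ into the adjointable operators on $\mathcal F$ such that $\langle \pi(b)x,Uy\rangle=\langle x,U\pi(b^*)y\rangle$ for all $b\in\mathcal B$, $x,y\in\mathcal F$; one writes $bx=\pi(b)x$. For a kernel $\mathfrak K$ let $\mathcal S(\mathcal F,\mathfrak K)$ be the set of all maps $\mathfrak i:\Omega\to\mathcal F$ such that $$\mathfrak K^{\sigma,\sigma'}(b)=\langle\mathfrak i(\sigma),b\,\mathfrak i(\sigma')\rangle=\langle\alpha(b^*)\mathfrak i(\sigma),\mathfrak i(\sigma')\rangle\quad\text{and}\quad U(b\,\mathfrak i(\sigma)c)=\alpha(b)\,\mathfrak i(\sigma)c$$ for all $\sigma,\sigma'\in\Omega$, $b\in\mathcal B$, $c\in\mathcal C$. A Kolmogorov decomposition of $\mathfrak K$ is a triple $(\mathcal F,U,\mathfrak i)$ with $\mathcal F$ an S-correspondence that is a von Neumann $\mathcal C$-module (i.e. strongly closed in the bounded operators from $H$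 to the interior tensor product $\mathcal F\otimes H$) and $\mathfrak i\in\mathcal S(\mathcal F,\mathfrak K)$; no minimality is required. **The sets and the distance.** Let $\mathfrak K_1,\mathfrak K_2$ be $\alpha$-CPD-kernels. A common S-correspondence is an S-correspondence $\mathcal F$ with $\mathcal S(\mathcal F,\mathfrak K_1)$ and $\mathcal S(\mathcal F,\mathfrak K_2)$ non-empty. For such $\mathcal F$ and $\sigma\in\Omega$ put $$N^\sigma_{\mathcal F}=\{\langle\mathfrak i_1(\sigma),\mathfrak i_2(\sigma)\rangle:\mathfrak i_m\in\mathcal S(\mathcal F,\mathfrak K_m)\},\qquad \beta_{\mathcal F}(\mathfrak K_1,\mathfrak K_2)=\inf\{\|\mathfrak i_1(\sigma)-\mathfrak i_2(\sigma)\|:\mathfrak i_m\in\mathcal S(\mathcal F,\mathfrak K_m),\ \sigma\in\Omega\},$$ and $N_{\mathcal F}(\mathfrak K_1,\mathfrak K_2)=\bigcup_\sigma N^\sigma_{\mathcal F}$. Let $N^\sigma$ and $N(\mathfrak K_1,\mathfrak K_2)$ be the unions of $N^\sigma_{\mathcal F}$ and of $N_{\mathcal F}(\mathfrak K_1,\mathfrak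 K_2)$ over all common S-correspondences $\mathcal F$, and let the Bures distance $\beta(\mathfrak K_1,\mathfrak K_2)$ be the infimum of $\beta_{\mathcal F}(\mathfrak K_1,\mathfrak K_2)$ over the same $\mathcal F$. For Kolmogorov decompositions $(\mathcal F_m,U_m,\mathfrak i_m)$ of $\mathfrak K_m$, $m=1,2$, put $$M^\sigma=\{\langle\mathfrak i_1(\sigma),T\mathfrak i_2(\sigma)\rangle: T:\mathcal F_2\to\mathcal F_1\ \text{adjointable},\ \mathcal B\text{-}\mathcal C\text{-bilinear},\ \|T\|\le1\},\qquad M(\mathfrak K_1,\mathfrak K_2)=\bigcup_{\sigma\in\Omega}M^\sigma .$$ **Proposition.** Let $(\mathcal F_m,U_m,\mathfrak i_m)$ be a Kolmogorov decomposition of $\mathfrak K_m$ for $m=1,2$. Then: (i) The sets $M^\sigma$ ($\sigma\in\Omega$), and hence $M(\mathfrak K_1,\mathfrak K_2)$, do not depend on the choice of the Kolmogorov decompositions. (ii) $M(\mathfrak K_1,\mathfrak K_2)=N(\mathfrak K_1,\mathfrak K_2)=N_{\mathcal F_1\oplus\mathcal F_2}(\mathfrak K_1,\mathfrak K_2)$,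 where $\mathcal F_1\oplus\mathcal F_2$ carries $U_1\oplus U_2$ and $\pi_1\oplus\pi_2$; moreover $M^\sigma=N^\sigma=N^\sigma_{\mathcal F_1\oplus\mathcal F_2}$ for every $\sigma\in\Omega$. (iii) $\beta(\mathfrak K_1,\mathfrak K_2)=\inf\{\|\mathfrak K_1^{\sigma,\sigma}(1)+\mathfrak K_2^{\sigma,\sigma}(1)-2\operatorname{Re}(m)\|^{1/2}:\sigma\in\Omega,\ m\in M^\sigma\}$, where $\operatorname{Re}(m)=\tfrac12(m+m^*)$. -/

import Mathlib

open scoped InnerProductSpace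

universe u v w w' z t

noncomputable section

namespace AlphaCPD

/-! ### Hilbert modules

A right Hilbert `C`-module is a complete `CStarModule` over `Cᵐᵒᵖ`: Mathlib's law
`⟪x, a • y⟫ = a * ⟪x, y⟫` over `Cᵐᵒᵖ` reads `⟨x, y c⟩ = ⟨x, y⟩ c` in `C`, where `y c` is
`MulOpposite.op c • y`. -/

section HilbertModules

variable {C : Type v} [CStarAlgebra C] [PartialOrder C] [StarOrderedRing C]
variable {E F : Type*}
  [NormedAddCommGroup E] [NormedSpace ℂ E] [SMul Cᵐᵒᵖ E] [CStarModule Cᵐᵒᵖ E]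
  [NormedAddCommGroup F] [NormedSpace ℂ F] [SMul Cᵐᵒᵖ F] [CStarModule Cᵐᵒᵖ F]

/-- The `C`-valued inner product of a right Hilbert `C`-module, linear in the second variable. -/
def ip (C : Type v) [CStarAlgebra C] [PartialOrder C] [StarOrderedRing C] {E : Type*}
    [NormedAddCommGroup E] [NormedSpace ℂ E] [SMul Cᵐᵒᵖ E] [CStarModule Cᵐᵒᵖ E] (x y : E) : C :=
  MulOpposite.unop (inner Cᵐᵒᵖ x y)

/-- `T` has an adjoint with respect to the `C`-valued inner products. -/
def IsAdjointable (C : Type v) [CStarAlgebra C] [PartialOrder C] [StarOrderedRing C]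
    {E F : Type*}
    [NormedAddCommGroup E] [NormedSpace ℂ E] [SMul Cᵐᵒᵖ E] [CStarModule Cᵐᵒᵖ E]
    [NormedAddCommGroup F] [NormedSpace ℂ F] [SMul Cᵐᵒᵖ F] [CStarModule Cᵐᵒᵖ F]
    (T : E →L[ℂ] F) : Prop :=
  ∃ S : F →L[ℂ] E, ∀ (x : E) (y : F), ip C (T x) y = ip C x (S y)

end HilbertModules

/-! ### Von Neumann algebras and von Neumann modules -/

section VonNeumann

variable {C : Type v} [CStarAlgebra C] [PartialOrder C] [StarOrderedRing C]
variable {H : Type z} [NormedAddCommGroup H] [InnerProductSpace ℂ H] [CompleteSpace H]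

/-- The faithful representation `ρ` identifies `C` with a von Neumann algebra acting on `H`. -/
structure ActsAsVonNeumannAlgebra (ρ : C →⋆ₐ[ℂ] (H →L[ℂ] H)) : Prop where
  injective : Function.Injective ρ
  range_eq : ∃ W : VonNeumannAlgebra H, (W : Set (H →L[ℂ] H)) = Set.range ρ

/-- `L : x ↦ L_x`, `L_x h = x ⊗ h`, exhibits the Hilbert space `K` as the interior tensor product
of the Hilbert `C`-module `F` with `H`: one has `L_x^* L_y = ⟨x, y⟩`, and the vectors `x ⊗ h` are
total in `K`. This determines `(K, L)` up to a unique unitary. -/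
structure IsInteriorTensor (ρ : C →⋆ₐ[ℂ] (H →L[ℂ] H)) {F : Type*}
    [NormedAddCommGroup F] [NormedSpace ℂ F] [SMul Cᵐᵒᵖ F] [CStarModule Cᵐᵒᵖ F]
    {K : Type*} [NormedAddCommGroup K] [InnerProductSpace ℂ K] [CompleteSpace K]
    (L : F →ₗ[ℂ] (H →L[ℂ] K)) : Prop where
  inner_eq : ∀ (x y : F) (h k : H), ⟪L x h, L y k⟫_ℂ = ⟪h, ρ (ip C x y) k⟫_ℂ
  total : (Submodule.span ℂ {k : K | ∃ (x : F) (h : H), k = L x h}).topologicalClosure = ⊤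

/-- `F` is a von Neumann module: it is closed in the strong operator topology when viewed, through
`x ↦ L_x`, as a subspace of the bounded operators from `H` to the interior tensor product. -/
def IsVonNeumannModule (ρ : C →⋆ₐ[ℂ] (H →L[ℂ] H)) (F : Type w)
    [NormedAddCommGroup F] [NormedSpace ℂ F] [SMul Cᵐᵒᵖ F] [CStarModule Cᵐᵒᵖ F] : Prop :=
  ∃ (K : Type (max w z)) (_ : NormedAddCommGroup K) (_ : InnerProductSpace ℂ K)
    (_ : CompleteSpace K) (L : F →ₗ[ℂ] (H →L[ℂ] K)),
    IsInteriorTensor ρ L ∧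
    IsClosed (Set.range fun x : F =>
      ContinuousLinearMap.toPointwiseConvergenceCLM ℂ (RingHom.id ℂ) H K (L x))

end VonNeumann

/-! ### `α`-completely positive definite kernels -/

section Kernels

variable {B : Type u} [CStarAlgebra B]
variable {C : Type v} [CStarAlgebra C] [PartialOrder C] [StarOrderedRing C]

/-- `κ` is an `α`-CPD-kernel over `Ω` from `B` to `C`. -/
structure IsAlphaCPD {Ω : Type*} (α : B ≃⋆ₐ[ℂ] B) (κ : Ω → Ω → B →L[ℂ] C) : Prop where
  hermitian : ∀ (σ σ' : Ω) (b : B), κ σ σ' (star b) = star (κ σ' σ b)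
  nonneg : ∀ (n : ℕ) (σ : Fin n → Ω) (b : Fin n → B) (c : Fin n → C),
    0 ≤ ∑ i, ∑ j, star (c i) * κ (σ i) (σ j) (star (α (b i)) * b j) * c j
  invariant : ∀ (σ σ' : Ω) (b : B), κ σ σ' (α b) = κ σ σ' b
  bound : ∀ b : B, ∃ M : ℝ, 0 < M ∧
    ∀ (n : ℕ) (σ : Fin n → Ω) (b' : Fin n → B) (c : Fin n → C),
      ‖∑ i, ∑ j, star (c i) *
          κ (σ i) (σ j) (α (star (b' i) * star b) * b * b' j) * c j‖ ≤
        M * ‖∑ i, ∑ j, star (c i) * κ (σ i) (σ j) (α (star (b' i)) * b' j) * c j‖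

end Kernels

/-! ### S-correspondences -/

/-- The structure of an S-correspondence from `B` to `C` on a Hilbert `C`-module `F`: a unitary `U`
on `F` and a (unital) `U`-representation `π` of `B` by adjointable operators on `F`. -/
structure SCorrespondence (B : Type u) [CStarAlgebra B]
    (C : Type v) [CStarAlgebra C] [PartialOrder C] [StarOrderedRing C]
    (F : Type w) [NormedAddCommGroup F] [NormedSpace ℂ F] [SMul Cᵐᵒᵖ F] [CStarModule Cᵐᵒᵖ F] where
  U : F ≃L[ℂ] F
  unitary : ∀ x y : F, ip C (U x) y = ip C x (U.symm y)
  π : B →ₐ[ℂ] (F →L[ℂ] F)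
  adjointable : ∀ b : B, IsAdjointable C (π b)
  uRep : ∀ (b : B) (x y : F), ip C (π b x) (U y) = ip C x (U (π (star b) y))

section Correspondences

variable {B : Type u} [CStarAlgebra B]
variable {C : Type v} [CStarAlgebra C] [PartialOrder C] [StarOrderedRing C]
variable {F : Type*}
  [NormedAddCommGroup F] [NormedSpace ℂ F] [SMul Cᵐᵒᵖ F] [CStarModule Cᵐᵒᵖ F]
variable {F₁ F₂ : Type*}
  [NormedAddCommGroup F₁] [NormedSpace ℂ F₁] [SMul Cᵐᵒᵖ F₁] [CStarModule Cᵐᵒᵖ F₁]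
  [NormedAddCommGroup F₂] [NormedSpace ℂ F₂] [SMul Cᵐᵒᵖ F₂] [CStarModule Cᵐᵒᵖ F₂]

/-- The Hilbert module direct sum, with
`⟨x₁ ⊕ x₂, y₁ ⊕ y₂⟩ = ⟨x₁, y₁⟩ + ⟨x₂, y₂⟩`. -/
abbrev DirectSum (C : Type v) (F₁ F₂ : Type*) := WithCStarModule Cᵐᵒᵖ (F₁ × F₂)

/-- `T₁ ⊕ T₂`. -/
def sumMap (T₁ : F₁ →L[ℂ] F₁) (T₂ : F₂ →L[ℂ] F₂) :
    DirectSum C F₁ F₂ →L[ℂ] DirectSum C F₁ F₂ :=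
  ((WithCStarModule.equivL (A := Cᵐᵒᵖ) (E := F₁ × F₂) ℂ).symm : _ →L[ℂ] _).comp
    ((T₁.prodMap T₂).comp (WithCStarModule.equivL (A := Cᵐᵒᵖ) (E := F₁ × F₂) ℂ : _ →L[ℂ] _))

/-- The direct sum of S-correspondences: `U = U₁ ⊕ U₂` and `π = π₁ ⊕ π₂`. -/
def SCorrespondence.directSum (D₁ : SCorrespondence B C F₁) (D₂ : SCorrespondence B C F₂) :
    SCorrespondence B C (DirectSum C F₁ F₂) where
  U := ContinuousLinearEquiv.equivOfInverse
    (sumMap (D₁.U : F₁ →L[ℂ] F₁) (D₂.U : F₂ →L[ℂ] F₂))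
    (sumMap (D₁.U.symm : F₁ →L[ℂ] F₁) (D₂.U.symm : F₂ →L[ℂ] F₂))
    (fun x => Prod.ext (D₁.U.symm_apply_apply x.1) (D₂.U.symm_apply_apply x.2))
    (fun x => Prod.ext (D₁.U.apply_symm_apply x.1) (D₂.U.apply_symm_apply x.2))
  unitary x y := congrArg₂ (· + ·) (D₁.unitary x.1 y.1) (D₂.unitary x.2 y.2)
  π := AlgHom.ofLinearMap
    { toFun := fun b => sumMap (D₁.π b) (D₂.π b)
      map_add' := fun a b => ContinuousLinearMap.ext fun x =>
        Prod.ext (congrArg (fun T => T x.1) (map_add D₁.π a b))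
          (congrArg (fun T => T x.2) (map_add D₂.π a b))
      map_smul' := fun a b => ContinuousLinearMap.ext fun x =>
        Prod.ext (congrArg (fun T => T x.1) (map_smul D₁.π a b))
          (congrArg (fun T => T x.2) (map_smul D₂.π a b)) }
    (ContinuousLinearMap.ext fun x =>
        Prod.ext (congrArg (fun T => T x.1) (map_one D₁.π))
          (congrArg (fun T => T x.2) (map_one D₂.π)))
    (fun a b => ContinuousLinearMap.ext fun x =>
        Prod.ext (congrArg (fun T => T x.1) (map_mul D₁.π a b))
          (congrArg (fun T => T x.2) (map_mul D₂.π a b)))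
  adjointable b := by
    obtain ⟨S₁, h₁⟩ := D₁.adjointable b
    obtain ⟨S₂, h₂⟩ := D₂.adjointable b
    exact ⟨sumMap S₁ S₂, fun x y => congrArg₂ (· + ·) (h₁ x.1 y.1) (h₂ x.2 y.2)⟩
  uRep b x y := congrArg₂ (· + ·) (D₁.uRep b x.1 y.1) (D₂.uRep b x.2 y.2)

/-- `T` is an adjointable bilinear map, i.e. an adjointable homomorphism of `B`-`C`-bimodules. -/
structure IsAdjointableBilinear (D : SCorrespondence B C F₁) (D' : SCorrespondence B C F₂)
    (T : F₁ →L[ℂ] F₂) : Prop where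
  adjointable : IsAdjointable C T
  map_left : ∀ (b : B) (x : F₁), T (D.π b x) = D'.π b (T x)
  map_right : ∀ (c : C) (x : F₁), T (MulOpposite.op c • x) = MulOpposite.op c • T x

variable {Ω : Type t}

/-- `(F, U, i)` is a (not necessarily minimal) Kolmogorov decomposition of the kernel `κ`. -/
structure IsKolmogorov (α : B ≃⋆ₐ[ℂ] B) (κ : Ω → Ω → B →L[ℂ] C)
    (D : SCorrespondence B C F) (i : Ω → F) : Prop where
  kernel_eq : ∀ (σ σ' : Ω) (b : B), κ σ σ' b = ip C (i σ) (D.π b (i σ'))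
  kernel_eq' : ∀ (σ σ' : Ω) (b : B), κ σ σ' b = ip C (D.π (α (star b)) (i σ)) (i σ')
  U_apply : ∀ (b : B) (σ : Ω) (c : C),
    D.U (MulOpposite.op c • D.π b (i σ)) = MulOpposite.op c • D.π (α b) (i σ)

/-- The set `𝒮(F, κ)`. -/
def solutions (α : B ≃⋆ₐ[ℂ] B) (D : SCorrespondence B C F) (κ : Ω → Ω → B →L[ℂ] C) :
    Set (Ω → F) :=
  {i | IsKolmogorov α κ D i}

/-- `F` is a common S-correspondence for `κ₁` and `κ₂`. -/
def IsCommon (α : B ≃⋆ₐ[ℂ] B) (D : SCorrespondence B C F) (κ₁ κ₂ : Ω → Ω → B →L[ℂ] C) : Prop :=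
  (solutions α D κ₁).Nonempty ∧ (solutions α D κ₂).Nonempty

/-- `β_F(κ₁, κ₂)`. -/
def buresOn (α : B ≃⋆ₐ[ℂ] B) (D : SCorrespondence B C F) (κ₁ κ₂ : Ω → Ω → B →L[ℂ] C) : ℝ :=
  sInf {r | ∃ i₁ ∈ solutions α D κ₁, ∃ i₂ ∈ solutions α D κ₂, ∃ σ : Ω, r = ‖i₁ σ - i₂ σ‖}

/-- The elements of `N_F(κ₁, κ₂)` that come from the point `σ`. -/
def NOnAt (α : B ≃⋆ₐ[ℂ] B) (D : SCorrespondence B C F) (κ₁ κ₂ : Ω → Ω → B →L[ℂ] C) (σ : Ω) :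
    Set C :=
  {m | ∃ i₁ ∈ solutions α D κ₁, ∃ i₂ ∈ solutions α D κ₂, m = ip C (i₁ σ) (i₂ σ)}

/-- `N_F(κ₁, κ₂)`. -/
def NOn (α : B ≃⋆ₐ[ℂ] B) (D : SCorrespondence B C F) (κ₁ κ₂ : Ω → Ω → B →L[ℂ] C) : Set C :=
  ⋃ σ : Ω, NOnAt α D κ₁ κ₂ σ

/-- The elements `⟨i₁(σ), T i₂(σ)⟩` of `M(κ₁, κ₂)` that come from the point `σ`, computed in the
decompositions `(F₁, U₁, i₁)` and `(F₂, U₂, i₂)`. -/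
def MAt (D₁ : SCorrespondence B C F₁) (i₁ : Ω → F₁) (D₂ : SCorrespondence B C F₂) (i₂ : Ω → F₂)
    (σ : Ω) : Set C :=
  {m | ∃ T : F₂ →L[ℂ] F₁, IsAdjointableBilinear D₂ D₁ T ∧ ‖T‖ ≤ 1 ∧ m = ip C (i₁ σ) (T (i₂ σ))}

/-- `M(κ₁, κ₂)`, computed in the decompositions `(F₁, U₁, i₁)` and `(F₂, U₂, i₂)`. -/
def M (D₁ : SCorrespondence B C F₁) (i₁ : Ω → F₁) (D₂ : SCorrespondence B C F₂) (i₂ : Ω → F₂) :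
    Set C :=
  ⋃ σ : Ω, MAt D₁ i₁ D₂ i₂ σ

/-- The elements of `N(κ₁, κ₂)` that come from the point `σ`: the union of the sets
`N_F(κ₁, κ₂)` at `σ` over all common S-correspondences `F`. -/
def NAt (α : B ≃⋆ₐ[ℂ] B) (κ₁ κ₂ : Ω → Ω → B →L[ℂ] C) (σ : Ω) : Set C :=
  {m | ∃ (F : Type w) (_ : NormedAddCommGroup F) (_ : NormedSpace ℂ F) (_ : SMul Cᵐᵒᵖ F)
    (_ : CStarModule Cᵐᵒᵖ F) (_ : CompleteSpace F) (D : SCorrespondence B C F),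
    IsCommon α D κ₁ κ₂ ∧ m ∈ NOnAt α D κ₁ κ₂ σ}

/-- `N(κ₁, κ₂)`. -/
def N (α : B ≃⋆ₐ[ℂ] B) (κ₁ κ₂ : Ω → Ω → B →L[ℂ] C) : Set C :=
  {m | ∃ (F : Type w) (_ : NormedAddCommGroup F) (_ : NormedSpace ℂ F) (_ : SMul Cᵐᵒᵖ F)
    (_ : CStarModule Cᵐᵒᵖ F) (_ : CompleteSpace F) (D : SCorrespondence B C F),
    IsCommon α D κ₁ κ₂ ∧ m ∈ NOn α D κ₁ κ₂}

/-- The Bures distance `β(κ₁, κ₂)`. -/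
def bures (α : B ≃⋆ₐ[ℂ] B) (κ₁ κ₂ : Ω → Ω → B →L[ℂ] C) : ℝ :=
  sInf {r | ∃ (F : Type w) (_ : NormedAddCommGroup F) (_ : NormedSpace ℂ F) (_ : SMul Cᵐᵒᵖ F)
    (_ : CStarModule Cᵐᵒᵖ F) (_ : CompleteSpace F) (D : SCorrespondence B C F),
    IsCommon α D κ₁ κ₂ ∧ r = buresOn α D κ₁ κ₂}

end Correspondences

end AlphaCPD

end

open AlphaCPD

set_option linter.unusedSectionVars false

noncomputable section

namespace AlphaCPD

/-! ### Calculus of the `C`-valued inner product -/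

section InnerProduct

variable {C : Type*} [CStarAlgebra C] [PartialOrder C] [StarOrderedRing C]
variable {E F : Type*}
  [NormedAddCommGroup E] [NormedSpace ℂ E] [SMul Cᵐᵒᵖ E] [CStarModule Cᵐᵒᵖ E]
  [NormedAddCommGroup F] [NormedSpace ℂ F] [SMul Cᵐᵒᵖ F] [CStarModule Cᵐᵒᵖ F]

/-! All parts follow from one transfer statement, `exists_transfer`. Take a bilinear contraction `T
: E₂ → E₁` between any decompositions `j₁`, `j₂` of the two kernels. It yields a bilinear
contraction `T' : F₂ → F₁` with the same coefficients `⟨i₁(σ), T' i₂(σ')⟩ = ⟨j₁(σ), T j₂(σ')⟩`,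
which moreover intertwines the unitaries and has a defect `S` with `T'⋆T' + S⋆S = 1` that is also
bilinear and equivariant. The `E` side need not consist of von Neumann modules.

Given this, independence of `M` is immediate. Transferring the identity of a common `F` gives `N ⊆
M`. For `M ⊆ N` on `F₁ ⊕ F₂`, the map `x ↦ T'x ⊕ Sx` is an equivariant isometry, so `i₁ ⊕ 0` and
`T'i₂ ⊕ S i₂` are solutions, and their inner product is `⟨i₁, T' i₂⟩`. The distance formula is the
expansion of `⟨i₁ - i₂, i₁ - i₂⟩`.

The transfer is made on the Hilbert spaces `F ⊗ H`. The Gram matrix of the vectors `π(b) i(σ) ⊗ h`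
depends only on the kernel, so two decompositions are linked by a partial isometry `W` between their
cyclic parts (`exists_intertwiner`), and `W₁⋆ (T ⊗ 1) W₂` has the required coefficients. Since `π`
is only a `U`-representation, `π(b)⋆ = U π(b⋆) U⋆`, commuting with `π` does not give commuting with
`π⋆`. Averaging over the powers of the unitaries (`exists_average`) repairs this: the limit
intertwines `U`, hence `π⋆`, and the coefficients survive because `U i(σ) = i(σ)`. The defect is
then the square root of `1 - A⋆A`.

Returning to modules uses the von Neumann hypotheses: an operator commuting with the amplified
commutant of `ρ` comes from an adjointable map (`CommutantLinear.exists_adjointable`), by the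
bicommutant property of `C` and the self-duality of strongly closed modules
(`IsInteriorTensor.exists_eq_of_isClosed`). -/

lemma ip_add_right (x y y' : E) : ip C x (y + y') = ip C x y + ip C x y' := by
  simp [ip]

lemma ip_sub_right (x y y' : E) : ip C x (y - y') = ip C x y - ip C x y' := by
  simp [ip]

lemma ip_sub_left (x x' y : E) : ip C (x - x') y = ip C x y - ip C x' y := by
  simp [ip]

lemma ip_zero_left (y : E) : ip C 0 y = 0 := by
  simp [ip]

lemma ip_zero_right (y : E) : ip C y 0 = 0 := by
  simp [ip]

lemma ip_smul_right (a : ℂ) (x y : E) : ip C x (a • y) = a • ip C x y := by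
  simp [ip]

lemma ip_op_smul_right (c : C) (x y : E) :
    ip C x (MulOpposite.op c • y) = ip C x y * c := by
  simp [ip]

lemma ip_op_smul_left (c : C) (x y : E) :
    ip C (MulOpposite.op c • x) y = star c * ip C x y := by
  simp [ip]

lemma star_ip (x y : E) : star (ip C x y) = ip C y x := by
  rw [ip, ip, ← CStarModule.star_inner x y, MulOpposite.unop_star]

lemma ip_self_nonneg (x : E) : 0 ≤ ip C x x :=
  CStarModule.inner_self_nonneg (A := Cᵐᵒᵖ) (x := x)

lemma ip_self_eq_zero {x : E} : ip C x x = 0 ↔ x = 0 := by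
  rw [ip, MulOpposite.unop_eq_zero_iff, CStarModule.inner_self]

lemma norm_sq_eq_norm_ip (x : E) : ‖x‖ ^ 2 = ‖ip C x x‖ :=
  CStarModule.norm_sq_eq Cᵐᵒᵖ

variable (C) in
lemma ext_ip {x y : E} (h : ∀ z, ip C z x = ip C z y) : x = y := by
  rw [← sub_eq_zero, ← ip_self_eq_zero (C := C), ip_sub_right, h, sub_self]

lemma op_one_smul (x : E) : MulOpposite.op (1 : C) • x = x :=
  ext_ip C fun z => by rw [ip_op_smul_right, mul_one]

/-- Adjointable maps are right linear. -/
lemma IsAdjointable.map_op_smul {T : E →L[ℂ] F} (hT : IsAdjointable C T) (c : C) (x : E) :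
    T (MulOpposite.op c • x) = MulOpposite.op c • T x := by
  obtain ⟨S, hS⟩ := hT
  have hS' : ∀ (y : F) (x : E), ip C y (T x) = ip C (S y) x := fun y x => by
    rw [← star_ip, hS, star_ip]
  exact ext_ip C fun y => by rw [hS', ip_op_smul_right, ip_op_smul_right, hS']

end InnerProduct

/-! ### Positive `C`-valued forms -/

section Gram

variable {C : Type*} [CStarAlgebra C] [PartialOrder C] [StarOrderedRing C]

/-- A self-adjoint element `a` of a `C⋆`-algebra is of the form `r⋆ r` as soon as its compression
by a certain self-adjoint element `n` degenerates. -/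
lemma exists_compression {A : Type*} [CStarAlgebra A] [PartialOrder A] [StarOrderedRing A] {a : A}
    (ha : IsSelfAdjoint a) :
    ∃ n q : A, star n = n ∧ n * a * n = -(star (q * n) * (q * n)) ∧
      (q * n = 0 → ∃ r, a = star r * r) := by
  have hnn : 0 ≤ a⁻ := CFC.negPart_nonneg a
  have hsaN : star a⁻ = a⁻ := hnn.isSelfAdjoint
  obtain ⟨q, hq⟩ := CStarAlgebra.nonneg_iff_eq_star_mul_self.mp hnn
  -- Take `n = a⁻` and `a⁻ = q⋆q`. Then `n a n = -(a⁻)³ = -(qn)⋆(qn)`, and `qn = 0` forces `(a⁻)² =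
  -- 0`, so `a ≥ 0`.
  refine ⟨a⁻, q, hsaN, ?_, fun h => ?_⟩
  · have h1 : a * a⁻ = -(a⁻ * a⁻) := by
      have h2 : a * a⁻ = (a⁺ - a⁻) * a⁻ := by rw [CFC.posPart_sub_negPart a ha]
      rw [h2, sub_mul, CFC.posPart_mul_negPart, zero_sub]
    rw [mul_assoc, h1, star_mul, hsaN, mul_neg, mul_assoc, ← mul_assoc (star q), ← hq]
  · have h1 : a⁻ * a⁻ = 0 := by
      nth_rewrite 1 [hq]
      rw [mul_assoc, h, mul_zero]
    have h2 : a⁻ = 0 := by rw [← CStarRing.star_mul_self_eq_zero_iff, hsaN, h1]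
    exact CStarAlgebra.nonneg_iff_eq_star_mul_self.mp ((CFC.negPart_eq_zero_iff a ha).mp h2)

/-- A self-adjoint matrix over a `C⋆`-algebra whose compressions to columns are positive has the
form `R⋆ R`. -/
lemma exists_eq_star_mul_of_column_nonneg {ι : Type*} [Fintype ι] [DecidableEq ι]
    (G : ι → ι → C) (hG : ∀ i j, star (G i j) = G j i)
    (hpos : ∀ c : ι → C, 0 ≤ ∑ k, ∑ l, star (c k) * G k l * c l) :
    ∃ R : ι → ι → C, ∀ k l, G k l = ∑ j, star (R j k) * R j l := by
  let A : CStarMatrix ι ι C := CStarMatrix.ofMatrix (Matrix.of G)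
  have hA : ∀ i j, A i j = G i j := fun _ _ => rfl
  have hsa : IsSelfAdjoint A := by
    refine CStarMatrix.ext fun i j => ?_
    rw [CStarMatrix.star_apply, hA, hA, hG]
  obtain ⟨N, Q, hsaN, hAN, hfac⟩ := exists_compression hsa
  have hdiag : ∀ i, (N * A * N) i i = ∑ k, ∑ l, star (N k i) * G k l * N l i := by
    intro i
    rw [mul_assoc, CStarMatrix.mul_apply]
    refine Finset.sum_congr rfl fun k _ => ?_
    rw [CStarMatrix.mul_apply, Finset.mul_sum]
    refine Finset.sum_congr rfl fun l _ => ?_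
    rw [hA, mul_assoc]
    congr 1
    rw [← CStarMatrix.star_apply, hsaN]
  -- A diagonal entry of `N A N` is the quadratic form evaluated at a column of `N`, hence
  -- nonnegative; it is also minus a sum of squares of entries of `QN`, so all of these vanish.
  have hQN : Q * N = 0 := by
    refine CStarMatrix.ext fun k i => ?_
    have h1 : 0 ≤ (N * A * N) i i := by rw [hdiag]; exact hpos _
    rw [hAN, CStarMatrix.neg_apply, CStarMatrix.mul_apply] at h1
    have h3 : ∀ j, 0 ≤ (star (Q * N)) i j * (Q * N) j i := fun j => by
      rw [CStarMatrix.star_apply]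
      exact star_mul_self_nonneg _
    have h2 : ∑ j, (star (Q * N)) i j * (Q * N) j i = 0 :=
      le_antisymm (by simpa using h1) (Finset.sum_nonneg fun j _ => h3 j)
    rw [Finset.sum_eq_zero_iff_of_nonneg fun j _ => h3 j] at h2
    have h4 := h2 k (Finset.mem_univ k)
    rw [CStarMatrix.star_apply] at h4
    exact (CStarRing.star_mul_self_eq_zero_iff _).mp h4
  obtain ⟨R, hR⟩ := hfac hQN
  refine ⟨fun j k => R j k, fun k l => ?_⟩
  rw [← hA, hR, CStarMatrix.mul_apply]
  rfl

section PositiveForm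

variable {E : Type*} [AddCommGroup E] [SMul Cᵐᵒᵖ E]

/-- The form `(x, y) ↦ f x y` is `C`-sesquilinear and positive. -/
structure IsPositiveForm (f : E → E → C) : Prop where
  add_right : ∀ x y z, f x (y + z) = f x y + f x z
  op_smul_right : ∀ x y (c : C), f x (MulOpposite.op c • y) = f x y * c
  star_form : ∀ x y, star (f x y) = f y x
  self_nonneg : ∀ x, 0 ≤ f x x

lemma IsPositiveForm.sum_right {C : Type*} [CStarAlgebra C] [PartialOrder C] [SMul Cᵐᵒᵖ E]
    {f : E → E → C} (hf : IsPositiveForm f) {ι : Type*} (s : Finset ι)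
    (x : E) (y : ι → E) : f x (∑ i ∈ s, y i) = ∑ i ∈ s, f x (y i) :=
  map_sum (AddMonoidHom.mk' (f x) (hf.add_right x)) y s

/-- Gram matrices of positive forms factorize. -/
lemma IsPositiveForm.exists_factorization {f : E → E → C} (hf : IsPositiveForm f) {ι : Type*}
    [Fintype ι] (x : ι → E) :
    ∃ R : ι → ι → C, ∀ k l, f (x k) (x l) = ∑ j, star (R j k) * R j l := by
  classical
  refine exists_eq_star_mul_of_column_nonneg (fun k l => f (x k) (x l))
    (fun _ _ => hf.star_form _ _) fun c => ?_
  have hleft : ∀ (y z : E) (c : C), f (MulOpposite.op c • y) z = star c * f y z := fun y z c => by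
    rw [← hf.star_form, hf.op_smul_right, star_mul, hf.star_form]
  have hsum : ∀ z, f (∑ k, MulOpposite.op (c k) • x k) z = ∑ k, star (c k) * f (x k) z := by
    intro z
    rw [← hf.star_form, hf.sum_right, star_sum]
    simp_rw [hf.star_form, hleft]
  have := hf.self_nonneg (∑ k, MulOpposite.op (c k) • x k)
  rw [hsum] at this
  simp_rw [hf.sum_right, hf.op_smul_right, Finset.mul_sum, ← mul_assoc] at this
  exact this

end PositiveForm

variable {E F : Type*}
  [NormedAddCommGroup E] [NormedSpace ℂ E] [SMul Cᵐᵒᵖ E] [CStarModule Cᵐᵒᵖ E]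
  [NormedAddCommGroup F] [NormedSpace ℂ F] [SMul Cᵐᵒᵖ F] [CStarModule Cᵐᵒᵖ F]

lemma isPositiveForm_ip : IsPositiveForm (fun x y : E => ip C x y) where
  add_right := ip_add_right
  op_smul_right x y c := ip_op_smul_right c x y
  star_form := star_ip
  self_nonneg := ip_self_nonneg

/-- Right linear bounded maps contract the `C`-valued inner product up to the norm. -/
lemma ip_map_le {S : E →L[ℂ] F}
    (hS : ∀ (c : C) (x : E), S (MulOpposite.op c • x) = MulOpposite.op c • S x) (x : E) :
    ip C (S x) (S x) ≤ ‖S‖ ^ 2 • ip C x x := by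
  set a := ip C x x
  set t := ip C (S x) (S x)
  have ha : 0 ≤ a := ip_self_nonneg x
  have ht : 0 ≤ t := ip_self_nonneg _
  -- Normalize: with `b = (⟨x,x⟩ + ε)^(-1/2)` the vector `x b` has norm at most `1`, so `b⟨Sx,Sx⟩b ≤
  -- ‖S‖²`; conjugating by `b⁻¹` gives the estimate. The `ε` only makes the root invertible.
  have key : ∀ ε : ℝ, 0 < ε → t ≤ ‖S‖ ^ 2 • (a + algebraMap ℝ C ε) := by
    intro ε hε
    set e := a + algebraMap ℝ C ε
    have he0 : 0 ≤ e := add_nonneg ha (by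
      rw [Algebra.algebraMap_eq_smul_one]; exact smul_nonneg hε.le zero_le_one)
    have heu : IsUnit e :=
      CStarAlgebra.isUnit_of_le (algebraMap ℝ C ε) (le_add_of_nonneg_left ha)
    obtain ⟨q, hq⟩ : ∃ q : C, q = CFC.sqrt e := ⟨_, rfl⟩
    have hq0 : 0 ≤ q := hq ▸ CFC.sqrt_nonneg e
    have hqs : star q = q := hq0.isSelfAdjoint
    have hqq : q * q = e := by rw [hq]; exact CFC.sqrt_mul_sqrt_self e he0
    have hqu : IsUnit q := by
      rw [← isUnit_pow_iff two_ne_zero, sq, hqq]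
      exact heu
    obtain ⟨qu, hqu'⟩ := hqu
    let b : C := ↑qu⁻¹
    have hqb : q * b = 1 := by rw [← hqu']; exact qu.mul_inv
    have hbq : b * q = 1 := by rw [← hqu']; exact qu.inv_mul
    have hbs : star b = b := by
      have h1 : star b * q = 1 := by rw [← hqs, ← star_mul, hqb, star_one]
      calc star b = star b * (q * b) := by rw [hqb, mul_one]
        _ = b := by rw [← mul_assoc, h1, one_mul]
    have h1 : star b * a * b ≤ 1 := by
      calc star b * a * b ≤ star b * e * b := star_left_conjugate_le_conjugate
            (le_add_of_nonneg_right (by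
              rw [Algebra.algebraMap_eq_smul_one]; exact smul_nonneg hε.le zero_le_one)) b
        _ = 1 := by rw [hbs, ← hqq, ← mul_assoc, hbq, one_mul, hqb]
    have h2 : ‖MulOpposite.op b • x‖ ≤ 1 := by
      have h3 : ‖MulOpposite.op b • x‖ ^ 2 = ‖star b * a * b‖ := by
        rw [norm_sq_eq_norm_ip (C := C), ip_op_smul_left, ip_op_smul_right, ← mul_assoc]
      have h4 : ‖star b * a * b‖ ≤ 1 := by
        rw [CStarAlgebra.norm_le_one_iff_of_nonneg _ (star_left_conjugate_nonneg ha b)]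
        exact h1
      nlinarith [norm_nonneg (MulOpposite.op b • x)]
    have h5 : ‖star b * t * b‖ ≤ ‖S‖ ^ 2 := by
      have h3 : ‖S (MulOpposite.op b • x)‖ ^ 2 = ‖star b * t * b‖ := by
        rw [norm_sq_eq_norm_ip (C := C), hS, ip_op_smul_left, ip_op_smul_right, ← mul_assoc]
      rw [← h3]
      have h6 : ‖S (MulOpposite.op b • x)‖ ≤ ‖S‖ :=
        (S.le_opNorm _).trans (mul_le_of_le_one_right (norm_nonneg _) h2)
      gcongr
    have h6 : star b * t * b ≤ algebraMap ℝ C (‖S‖ ^ 2) :=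
      (CStarAlgebra.norm_le_iff_le_algebraMap _ (by positivity)
        (star_left_conjugate_nonneg ht b)).mp h5
    have h7 := star_left_conjugate_le_conjugate h6 q
    have h8 : star q * (star b * t * b) * q = t := by
      rw [hqs, hbs]
      calc q * (b * t * b) * q = (q * b) * t * (b * q) := by simp only [mul_assoc]
        _ = t := by rw [hqb, hbq, one_mul, mul_one]
    rw [h8, hqs, Algebra.algebraMap_eq_smul_one, mul_smul_comm, smul_mul_assoc, mul_one, hqq] at h7
    exact h7
  have hlim : Filter.Tendsto (fun ε : ℝ => ‖S‖ ^ 2 • (a + algebraMap ℝ C ε))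
      (nhdsWithin 0 (Set.Ioi 0)) (nhds (‖S‖ ^ 2 • (a + algebraMap ℝ C 0))) := by
    refine Filter.Tendsto.mono_left (Continuous.tendsto ?_ 0) nhdsWithin_le_nhds
    have := (algebraMapCLM ℝ C).continuous
    exact continuous_const.smul (continuous_const.add this)
  rw [map_zero, add_zero] at hlim
  exact ge_of_tendsto hlim (Filter.eventually_of_mem self_mem_nhdsWithin key)

/-- Factorizing the Gram matrices of this form is what bounds `S ⊗ 1` by `‖S‖`. -/
lemma isPositiveForm_sub {S : E →L[ℂ] F}
    (hS : ∀ (c : C) (x : E), S (MulOpposite.op c • x) = MulOpposite.op c • S x) :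
    IsPositiveForm (fun x y : E => ‖S‖ ^ 2 • ip C x y - ip C (S x) (S y)) where
  add_right x y z := by
    rw [map_add, ip_add_right, ip_add_right, smul_add]; abel
  op_smul_right x y c := by
    rw [hS, ip_op_smul_right, ip_op_smul_right, sub_mul, smul_mul_assoc]
  star_form x y := by
    rw [star_sub, star_smul, star_ip, star_ip, star_trivial]
  self_nonneg x := sub_nonneg.mpr (ip_map_le hS x)

end Gram

end AlphaCPD

end

noncomputable section

namespace AlphaCPD

/-! ### Extension of maps from total families of a Hilbert space -/

section Extension

variable {ι K K' : Type*} [NormedAddCommGroup K'] [InnerProductSpace ℂ K'] [CompleteSpace K']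
  [NormedAddCommGroup K] [InnerProductSpace ℂ K] [CompleteSpace K]

/-- A bounded assignment `a i ↦ b i` extends to a bounded operator which vanishes on the
orthogonal complement of the family `a`. -/
lemma exists_extension (a : ι → K) (b : ι → K') {r : ℝ} (hr : 0 ≤ r)
    (h : ∀ c : ι →₀ ℂ,
      ‖Finsupp.linearCombination ℂ b c‖ ≤ r * ‖Finsupp.linearCombination ℂ a c‖) :
    ∃ W : K →L[ℂ] K', ‖W‖ ≤ r ∧ (∀ i, W (a i) = b i) ∧
      ∀ k, (∀ i, ⟪a i, k⟫_ℂ = 0) → W k = 0 := by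
  let S : Submodule ℂ K := (Submodule.span ℂ (Set.range a)).topologicalClosure
  have hS : IsClosed (S : Set K) := Submodule.isClosed_topologicalClosure _
  have : CompleteSpace S := hS.completeSpace_coe
  have hmem : ∀ c, Finsupp.linearCombination ℂ a c ∈ S := fun c =>
    Submodule.le_topologicalClosure _ (Finsupp.mem_span_range_iff_exists_finsupp.mpr ⟨c, rfl⟩)
  let e : (ι →₀ ℂ) →ₗ[ℂ] S := (Finsupp.linearCombination ℂ a).codRestrict S hmem
  let f : (ι →₀ ℂ) →ₗ[ℂ] K' := Finsupp.linearCombination ℂ b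
  have hdense : DenseRange e := by
    intro x
    have hx : (x : K) ∈ closure (Submodule.span ℂ (Set.range a) : Set K) := x.2
    rw [closure_subtype]
    convert hx using 2
    ext k
    constructor
    · rintro ⟨_, ⟨c, rfl⟩, rfl⟩
      exact Finsupp.mem_span_range_iff_exists_finsupp.mpr ⟨c, rfl⟩
    · intro hk
      obtain ⟨c, hc⟩ := Finsupp.mem_span_range_iff_exists_finsupp.mp hk
      exact ⟨e c, ⟨c, rfl⟩, hc⟩
  have hnorm : ∀ c, ‖f c‖ ≤ r * ‖e c‖ := h
  let V : S →L[ℂ] K' := f.extendOfNorm e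
  have hV : ∀ c, V (e c) = f c := LinearMap.extendOfNorm_eq hdense ⟨r, hnorm⟩
  have hVn : ∀ s, ‖V s‖ ≤ r * ‖s‖ := LinearMap.norm_extendOfNorm_apply_le hdense r hnorm
  -- Extend by continuity to the closed span, then precompose with the projection onto it, which
  -- gives the vanishing on the complement.
  refine ⟨V ∘L S.orthogonalProjectionOnto, ?_, fun i => ?_, fun k hk => ?_⟩
  · refine ContinuousLinearMap.opNorm_le_bound _ hr fun k => ?_
    refine (hVn _).trans (mul_le_mul_of_nonneg_left ?_ hr)
    exact S.norm_orthogonalProjectionOnto_apply_le k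
  · have h1 : ((e (Finsupp.single i 1) : S) : K) = a i := by simp [e]
    have h2 : S.orthogonalProjectionOnto (a i) = e (Finsupp.single i 1) := by
      rw [← h1]; exact S.orthogonalProjectionOnto_mem_subspace_eq_self _
    rw [ContinuousLinearMap.comp_apply, h2, hV]
    simp [f]
  · have h1 : k ∈ Sᗮ := by
      rw [Submodule.orthogonal_closure, Submodule.mem_orthogonal]
      intro s hs
      induction hs using Submodule.span_induction with
      | mem x hx => obtain ⟨i, rfl⟩ := hx; exact hk i
      | zero => simp
      | add x y _ _ hx hy => rw [inner_add_left, hx, hy, add_zero]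
      | smul c x _ hx => rw [inner_smul_left, hx, mul_zero]
    rw [ContinuousLinearMap.comp_apply,
      Submodule.orthogonalProjectionOnto_eq_zero_iff.mpr h1, map_zero]

/-- Families with the same Gram matrix are related by a partial isometry. -/
lemma exists_partialIsometry (a : ι → K) (b : ι → K') (h : ∀ i j, ⟪a i, a j⟫_ℂ = ⟪b i, b j⟫_ℂ) :
    ∃ W : K →L[ℂ] K', ‖W‖ ≤ 1 ∧ (∀ i, W (a i) = b i) ∧
      ∀ k, (∀ i, ⟪a i, k⟫_ℂ = 0) → W k = 0 := by
  refine exists_extension a b zero_le_one fun c => le_of_eq ?_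
  have h2 : ⟪Finsupp.linearCombination ℂ b c, Finsupp.linearCombination ℂ b c⟫_ℂ =
      ⟪Finsupp.linearCombination ℂ a c, Finsupp.linearCombination ℂ a c⟫_ℂ := by
    simp only [Finsupp.linearCombination_apply, Finsupp.sum_inner, Finsupp.inner_sum,
      inner_smul_left, inner_smul_right, h]
  have h3 : ‖Finsupp.linearCombination ℂ b c‖ ^ 2 = ‖Finsupp.linearCombination ℂ a c‖ ^ 2 := by
    rw [← inner_self_eq_norm_sq (𝕜 := ℂ), ← inner_self_eq_norm_sq (𝕜 := ℂ), h2]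
  rw [one_mul]
  exact (sq_eq_sq₀ (norm_nonneg _) (norm_nonneg _)).mp h3

/-- A partial isometry `g j ↦ g' j` intertwines operators that act in the same way on the two
families. -/
lemma partialIsometry_intertwines {g : ι → K} {g' : ι → K'} {W : K →L[ℂ] K'}
    (hW : ∀ j, W (g j) = g' j) (hW0 : ∀ k, (∀ j, ⟪g j, k⟫_ℂ = 0) → W k = 0)
    {X : K →L[ℂ] K} {X' : K' →L[ℂ] K'} {θ θ' : ι → ι} (hX : ∀ j, X (g j) = g (θ j))
    (hX' : ∀ j, X' (g' j) = g' (θ j))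
    (hXs : ∀ j, ContinuousLinearMap.adjoint X (g j) = g (θ' j)) :
    W ∘L X = X' ∘L W := by
  let S : Submodule ℂ K := (Submodule.span ℂ (Set.range g)).topologicalClosure
  have hS : IsClosed (S : Set K) := Submodule.isClosed_topologicalClosure _
  have : CompleteSpace S := hS.completeSpace_coe
  have hgS : ∀ j, g j ∈ S := fun j =>
    Submodule.le_topologicalClosure _ (Submodule.subset_span ⟨j, rfl⟩)
  have hon : ∀ k ∈ S, (W ∘L X) k = (X' ∘L W) k := by
    have hle : S ≤ LinearMap.ker ((W ∘L X - X' ∘L W : K →L[ℂ] K') : K →ₗ[ℂ] K') := by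
      refine Submodule.topologicalClosure_minimal _ (Submodule.span_le.mpr ?_)
        (ContinuousLinearMap.isClosed_ker _)
      rintro _ ⟨j, rfl⟩
      simp [hX, hW, hX']
    intro k hk
    have := hle hk
    simpa [sub_eq_zero] using this
  -- Since `X⋆` preserves the family, `X` preserves its orthogonal complement, where `W` vanishes.
  have hoff : ∀ k ∈ Sᗮ, (W ∘L X) k = (X' ∘L W) k := by
    intro k hk
    have hk' : ∀ j, ⟪g j, k⟫_ℂ = 0 := fun j => (Submodule.mem_orthogonal _ _).mp hk _ (hgS j)
    have h1 : W k = 0 := hW0 k hk'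
    have h2 : W (X k) = 0 := hW0 _ fun j => by
      rw [← ContinuousLinearMap.adjoint_inner_left, hXs, hk']
    simp [h1, h2]
  ext k
  obtain ⟨y, hy, z, hz, rfl⟩ := S.exists_add_mem_mem_orthogonal k
  rw [map_add, map_add, hon y hy, hoff z hz]

end Extension

/-! ### Interior tensor products -/

section InteriorTensor

variable {C : Type*} [CStarAlgebra C] [PartialOrder C] [StarOrderedRing C]
variable {H : Type*} [NormedAddCommGroup H] [InnerProductSpace ℂ H] [CompleteSpace H]
variable {ρ : C →⋆ₐ[ℂ] (H →L[ℂ] H)}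
variable {F : Type*} [NormedAddCommGroup F] [NormedSpace ℂ F] [SMul Cᵐᵒᵖ F] [CStarModule Cᵐᵒᵖ F]
variable {F' : Type*} [NormedAddCommGroup F'] [NormedSpace ℂ F'] [SMul Cᵐᵒᵖ F']
  [CStarModule Cᵐᵒᵖ F']
variable {K : Type*} [NormedAddCommGroup K] [InnerProductSpace ℂ K] [CompleteSpace K]
variable {K' : Type*} [NormedAddCommGroup K'] [InnerProductSpace ℂ K'] [CompleteSpace K']
variable {L : F →ₗ[ℂ] (H →L[ℂ] K)} {L' : F' →ₗ[ℂ] (H →L[ℂ] K')}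

lemma inner_map_star_left (a : C) (h k : H) : ⟪ρ (star a) h, k⟫_ℂ = ⟪h, ρ a k⟫_ℂ := by
  rw [map_star, ContinuousLinearMap.star_eq_adjoint, ContinuousLinearMap.adjoint_inner_left]

namespace IsInteriorTensor

lemma ext_inner (hL : IsInteriorTensor ρ L) {k k' : K}
    (h : ∀ x g, ⟪L x g, k⟫_ℂ = ⟪L x g, k'⟫_ℂ) : k = k' := by
  have h0 : k - k' ∈ (Submodule.span ℂ {k : K | ∃ (x : F) (h : H), k = L x h})ᗮ := by
    rw [Submodule.mem_orthogonal]
    intro s hs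
    induction hs using Submodule.span_induction with
    | mem x hx => obtain ⟨x, g, rfl⟩ := hx; rw [inner_sub_right, h, sub_self]
    | zero => simp
    | add x y _ _ hx hy => rw [inner_add_left, hx, hy, add_zero]
    | smul c x _ hx => rw [inner_smul_left, hx, mul_zero]
  rw [← Submodule.orthogonal_closure, hL.total, Submodule.top_orthogonal_eq_bot,
    Submodule.mem_bot] at h0
  exact sub_eq_zero.mp h0

lemma ext_clm (hL : IsInteriorTensor ρ L) {M : Type*} [NormedAddCommGroup M]
    [InnerProductSpace ℂ M] [CompleteSpace M] {X Y : K →L[ℂ] M}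
    (h : ∀ x g, X (L x g) = Y (L x g)) : X = Y := by
  ext k
  refine ext_inner_left ℂ fun m => ?_
  rw [← ContinuousLinearMap.adjoint_inner_left, ← ContinuousLinearMap.adjoint_inner_left]
  congr 1
  refine hL.ext_inner fun x g => ?_
  rw [ContinuousLinearMap.adjoint_inner_right, ContinuousLinearMap.adjoint_inner_right, h]

lemma apply_op_smul (hL : IsInteriorTensor ρ L) (c : C) (x : F) (h : H) :
    L (MulOpposite.op c • x) h = L x (ρ c h) :=
  hL.ext_inner fun y g => by
    rw [hL.inner_eq, hL.inner_eq, ip_op_smul_right, map_mul]; rfl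

lemma adjoint_comp (hL : IsInteriorTensor ρ L) (x y : F) :
    ContinuousLinearMap.adjoint (L x) ∘L L y = ρ (ip C x y) := by
  ext h
  refine ext_inner_left ℂ fun g => ?_
  rw [ContinuousLinearMap.comp_apply, ContinuousLinearMap.adjoint_inner_right, hL.inner_eq]

/-- An injective star homomorphism is isometric, and `L_x⋆ L_x = ρ⟨x,x⟩`. -/
lemma norm_apply (hL : IsInteriorTensor ρ L) (hρ : Function.Injective ρ) (x : F) :
    ‖L x‖ = ‖x‖ := by
  have h1 : ‖L x‖ ^ 2 = ‖x‖ ^ 2 := by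
    rw [norm_sq_eq_norm_ip (C := C) x, ← NonUnitalStarAlgHom.norm_map ρ hρ, ← hL.adjoint_comp,
      ContinuousLinearMap.norm_adjoint_comp_self, sq]
  exact (sq_eq_sq₀ (norm_nonneg _) (norm_nonneg _)).mp h1

lemma injective (hL : IsInteriorTensor ρ L) (hρ : Function.Injective ρ) :
    Function.Injective L := by
  rw [injective_iff_map_eq_zero]
  intro x hx
  rw [← norm_eq_zero, ← hL.norm_apply hρ, hx, norm_zero]

lemma norm_sum_sq (hL : IsInteriorTensor ρ L) {ι : Type*} [Fintype ι] (x : ι → F) (g : ι → H) :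
    ‖∑ i, L (x i) (g i)‖ ^ 2 = (∑ k, ∑ l, ⟪g k, ρ (ip C (x k) (x l)) (g l)⟫_ℂ).re := by
  rw [← inner_self_eq_norm_sq (𝕜 := ℂ), sum_inner]
  simp only [inner_sum, hL.inner_eq]
  rfl

end IsInteriorTensor

/-- A factorization of the coefficients turns a quadratic form into a sum of squares. -/
lemma sum_inner_eq_sum_norm_sq {ι : Type*} [Fintype ι] {G : ι → ι → C} {R : ι → ι → C}
    (hR : ∀ k l, G k l = ∑ j, star (R j k) * R j l) (g : ι → H) :
    (∑ k, ∑ l, ⟪g k, ρ (G k l) (g l)⟫_ℂ).re = ∑ j, ‖∑ l, ρ (R j l) (g l)‖ ^ 2 := by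
  have h1 : ∑ k, ∑ l, ⟪g k, ρ (G k l) (g l)⟫_ℂ =
      ∑ j, ⟪∑ k, ρ (R j k) (g k), ∑ l, ρ (R j l) (g l)⟫_ℂ := by
    have h2 : ∀ k l j, ⟪g k, ρ (star (R j k) * R j l) (g l)⟫_ℂ =
        ⟪ρ (R j k) (g k), ρ (R j l) (g l)⟫_ℂ := fun k l j => by
      rw [← star_star (R j k), inner_map_star_left, star_star, map_mul]; rfl
    calc ∑ k, ∑ l, ⟪g k, ρ (G k l) (g l)⟫_ℂ
        = ∑ k, ∑ l, ∑ j, ⟪ρ (R j k) (g k), ρ (R j l) (g l)⟫_ℂ := by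
          simp only [hR, map_sum, sum_apply, inner_sum, h2]
      _ = ∑ k, ∑ j, ∑ l, ⟪ρ (R j k) (g k), ρ (R j l) (g l)⟫_ℂ :=
          Finset.sum_congr rfl fun k _ => Finset.sum_comm
      _ = ∑ j, ∑ k, ∑ l, ⟪ρ (R j k) (g k), ρ (R j l) (g l)⟫_ℂ := Finset.sum_comm
      _ = _ := by simp only [sum_inner]; simp only [inner_sum]
  rw [h1, Complex.re_sum]
  exact Finset.sum_congr rfl fun j _ => inner_self_eq_norm_sq (𝕜 := ℂ) _

end InteriorTensor

end AlphaCPD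

end

noncomputable section

namespace AlphaCPD

/-! ### Lifting module maps and commutant operators to interior tensor products. -/

section Lifting

variable {C : Type*} [CStarAlgebra C] [PartialOrder C] [StarOrderedRing C]
variable {H : Type*} [NormedAddCommGroup H] [InnerProductSpace ℂ H] [CompleteSpace H]
variable {ρ : C →⋆ₐ[ℂ] (H →L[ℂ] H)}
variable {F : Type*} [NormedAddCommGroup F] [NormedSpace ℂ F] [SMul Cᵐᵒᵖ F] [CStarModule Cᵐᵒᵖ F]
variable {F' : Type*} [NormedAddCommGroup F'] [NormedSpace ℂ F'] [SMul Cᵐᵒᵖ F']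
  [CStarModule Cᵐᵒᵖ F']
variable {K : Type*} [NormedAddCommGroup K] [InnerProductSpace ℂ K] [CompleteSpace K]
variable {K' : Type*} [NormedAddCommGroup K'] [InnerProductSpace ℂ K'] [CompleteSpace K']
variable {L' : F' →ₗ[ℂ] (H →L[ℂ] K')} {L : F →ₗ[ℂ] (H →L[ℂ] K)}

/-- Right linear maps act on the interior tensor products as `S ⊗ 1`. -/
lemma IsInteriorTensor.exists_lift (hL : IsInteriorTensor ρ L) (hL' : IsInteriorTensor ρ L')
    {S : F →L[ℂ] F'}
    (hS : ∀ (c : C) (x : F), S (MulOpposite.op c • x) = MulOpposite.op c • S x) :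
    ∃ X : K →L[ℂ] K', ‖X‖ ≤ ‖S‖ ∧ ∀ x h, X (L x h) = L' (S x) h := by
  suffices key : ∀ c : F × H →₀ ℂ,
      ‖Finsupp.linearCombination ℂ (fun p : F × H => L' (S p.1) p.2) c‖ ≤
        ‖S‖ * ‖Finsupp.linearCombination ℂ (fun p : F × H => L p.1 p.2) c‖ by
    obtain ⟨X, hX, hX', -⟩ := exists_extension _ _ (norm_nonneg S) key
    exact ⟨X, hX, fun x h => hX' (x, h)⟩
  intro c
  -- Absorb the scalar coefficients into the vectors of `H`, so that the tensors become `∑ xᵢ ⊗ gᵢ`.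
  let x : c.support → F := fun i => i.1.1
  let g : c.support → H := fun i => c i.1 • i.1.2
  have h1 : Finsupp.linearCombination ℂ (fun p : F × H => L p.1 p.2) c = ∑ i, L (x i) (g i) := by
    rw [Finsupp.linearCombination_apply, Finsupp.sum, ← Finset.sum_coe_sort]
    simp [x, g]
  have h2 : Finsupp.linearCombination ℂ (fun p : F × H => L' (S p.1) p.2) c =
      ∑ i, L' (S (x i)) (g i) := by
    rw [Finsupp.linearCombination_apply, Finsupp.sum, ← Finset.sum_coe_sort]
    simp [x, g]
  rw [h1, h2]
  obtain ⟨R, hR⟩ := (isPositiveForm_sub hS).exists_factorization x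
  have h3 := sum_inner_eq_sum_norm_sq (ρ := ρ) hR g
  have h4 : ‖∑ i, L' (S (x i)) (g i)‖ ^ 2 ≤ (‖S‖ * ‖∑ i, L (x i) (g i)‖) ^ 2 := by
    rw [mul_pow, hL.norm_sum_sq, hL'.norm_sum_sq, ← sub_nonneg]
    -- The difference of the squared norms is the quadratic form of the factorized Gram matrix,
    -- hence a sum of squares.
    have h5 : ‖S‖ ^ 2 * (∑ k, ∑ l, ⟪g k, ρ (ip C (x k) (x l)) (g l)⟫_ℂ).re -
        (∑ k, ∑ l, ⟪g k, ρ (ip C (S (x k)) (S (x l))) (g l)⟫_ℂ).re =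
        (∑ k, ∑ l, ⟪g k, ρ (‖S‖ ^ 2 • ip C (x k) (x l) - ip C (S (x k)) (S (x l))) (g l)⟫_ℂ).re := by
      have h6 : ∀ (a b : C) (f f' : H), ⟪f, ρ (‖S‖ ^ 2 • a - b) f'⟫_ℂ =
          ((‖S‖ ^ 2 : ℝ) : ℂ) * ⟪f, ρ a f'⟫_ℂ - ⟪f, ρ b f'⟫_ℂ := by
        intro a b f f'
        rw [map_sub, ← Complex.coe_smul, map_smul, sub_apply, inner_sub_right, smul_apply,
          inner_smul_right]
      simp only [h6, Finset.sum_sub_distrib, ← Finset.mul_sum, Complex.sub_re,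
        Complex.re_ofReal_mul]
    rw [h5, h3]
    positivity
  exact (pow_le_pow_iff_left₀ (norm_nonneg _) (by positivity) two_ne_zero).mp h4

/-- Operators in the commutant of `ρ` act on the interior tensor product as `1 ⊗ w`. -/
lemma IsInteriorTensor.exists_amplification (hL : IsInteriorTensor ρ L) {w : H →L[ℂ] H}
    (hw : ∀ c, Commute (ρ c) w) :
    ∃ X : K →L[ℂ] K, ∀ x h, X (L x h) = L x (w h) := by
  suffices key : ∀ c : F × H →₀ ℂ,
      ‖Finsupp.linearCombination ℂ (fun p : F × H => L p.1 (w p.2)) c‖ ≤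
        ‖w‖ * ‖Finsupp.linearCombination ℂ (fun p : F × H => L p.1 p.2) c‖ by
    obtain ⟨X, -, hX', -⟩ := exists_extension _ _ (norm_nonneg w) key
    exact ⟨X, fun x h => hX' (x, h)⟩
  intro c
  let x : c.support → F := fun i => i.1.1
  let g : c.support → H := fun i => c i.1 • i.1.2
  have h1 : Finsupp.linearCombination ℂ (fun p : F × H => L p.1 p.2) c = ∑ i, L (x i) (g i) := by
    rw [Finsupp.linearCombination_apply, Finsupp.sum, ← Finset.sum_coe_sort]
    simp [x, g]
  have h2 : Finsupp.linearCombination ℂ (fun p : F × H => L p.1 (w p.2)) c =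
      ∑ i, L (x i) (w (g i)) := by
    rw [Finsupp.linearCombination_apply, Finsupp.sum, ← Finset.sum_coe_sort]
    simp [x, g]
  rw [h1, h2]
  obtain ⟨R, hR⟩ := (isPositiveForm_ip (C := C)).exists_factorization x
  have hcomm : ∀ c h, ρ c (w h) = w (ρ c h) := fun c h => DFunLike.congr_fun (hw c).eq h
  have h4 : ‖∑ i, L (x i) (w (g i))‖ ^ 2 ≤ (‖w‖ * ‖∑ i, L (x i) (g i)‖) ^ 2 := by
    rw [mul_pow, hL.norm_sum_sq, hL.norm_sum_sq, sum_inner_eq_sum_norm_sq (ρ := ρ) hR,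
      sum_inner_eq_sum_norm_sq (ρ := ρ) hR, Finset.mul_sum]
    -- Both norms are now sums of squares through the same `ρ(R j l)`, and `w` can be pulled out of
    -- each term because it commutes with `ρ`.
    refine Finset.sum_le_sum fun j _ => ?_
    simp only [hcomm]
    rw [← map_sum, ← mul_pow]
    gcongr
    exact w.le_opNorm _
  exact (pow_le_pow_iff_left₀ (norm_nonneg _) (by positivity) two_ne_zero).mp h4

/-- Every Hilbert module has an interior tensor product with `H`. -/
lemma exists_isInteriorTensor {F : Type w} [NormedAddCommGroup F] [NormedSpace ℂ F]
    [SMul Cᵐᵒᵖ F] [CStarModule Cᵐᵒᵖ F] {H : Type z} [NormedAddCommGroup H]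
    [InnerProductSpace ℂ H] [CompleteSpace H] (ρ : C →⋆ₐ[ℂ] (H →L[ℂ] H)) :
    ∃ (K : Type (max w z)) (_ : NormedAddCommGroup K) (_ : InnerProductSpace ℂ K)
      (_ : CompleteSpace K) (L : F →ₗ[ℂ] (H →L[ℂ] K)), IsInteriorTensor ρ L := by
  -- The interior tensor product is the reproducing kernel Hilbert space of `(x, y) ↦ ρ⟨x,y⟩`, with
  -- the kernel function at `x` applied to `h` in the role of `x ⊗ h`.
  let G : Matrix F F (H →L[ℂ] H) := fun x y => ρ (ip C x y)
  have hH : G.IsHermitian := Matrix.IsHermitian.ext fun x y => by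
    simp only [G]
    rw [← map_star, star_ip]
  have hpos : G.PosSemidef := by
    have htfae := (RKHS.posSemidef_tfae (K := G)).out 0 2
    refine htfae.mpr ⟨hH, fun vv => ?_⟩
    let x : vv.support → F := fun i => i.1
    let g : vv.support → H := fun i => vv i.1
    obtain ⟨R, hR⟩ := (isPositiveForm_ip (C := C)).exists_factorization x
    have h3 := sum_inner_eq_sum_norm_sq (ρ := ρ) hR g
    have h4 : (vv.sum fun x w => vv.sum fun x' w' => ⟪G x' x w, w'⟫_ℂ) =
        ∑ k, ∑ l, ⟪g k, ρ (ip C (x k) (x l)) (g l)⟫_ℂ := by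
      simp only [Finsupp.sum, ← Finset.sum_coe_sort vv.support]
      refine Finset.sum_congr rfl fun k _ => Finset.sum_congr rfl fun l _ => ?_
      rw [← inner_map_star_left, star_ip]
    rw [h4]
    have h5 : 0 ≤ ∑ j, ‖∑ l, ρ (R j l) (g l)‖ ^ 2 := by positivity
    rw [← h3] at h5
    exact h5
  have : Fact G.PosSemidef := ⟨hpos⟩
  have hin : ∀ (x y : F) (h k : H), ⟪RKHS.kerFun (RKHS.OfKernel G) x h,
      RKHS.kerFun (RKHS.OfKernel G) y k⟫_ℂ = ⟪h, ρ (ip C x y) k⟫_ℂ := by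
    intro x y h k
    rw [← RKHS.kernel_inner, RKHS.OfKernel.kernel_ofKernel, ← inner_map_star_left, star_ip]
  have hext : ∀ {f g : RKHS.OfKernel G},
      (∀ x h, ⟪RKHS.kerFun (RKHS.OfKernel G) x h, f⟫_ℂ =
        ⟪RKHS.kerFun (RKHS.OfKernel G) x h, g⟫_ℂ) → f = g := by
    intro f g h
    refine RKHS.ext (𝕜 := ℂ) (X := F) (V := H) fun x => ext_inner_left ℂ fun v => ?_
    rw [← RKHS.kerFun_inner, ← RKHS.kerFun_inner, h]
  let L : F →ₗ[ℂ] (H →L[ℂ] RKHS.OfKernel G) :=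
    { toFun := fun x => RKHS.kerFun (RKHS.OfKernel G) x
      map_add' := fun x y => by
        ext h : 1
        refine hext fun z k => ?_
        rw [add_apply, inner_add_right, hin, hin, hin, ip_add_right, map_add, add_apply,
          inner_add_right]
      map_smul' := fun a x => by
        ext h : 1
        refine hext fun z k => ?_
        rw [RingHom.id_apply, smul_apply, inner_smul_right, hin, hin, ip_smul_right,
          map_smul, smul_apply, inner_smul_right] }
  refine ⟨RKHS.OfKernel G, inferInstance, inferInstance, inferInstance, L, hin, ?_⟩
  have hd := RKHS.kerFun_dense (𝕜 := ℂ) (X := F) (V := H) (RKHS.OfKernel G)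
  have hset : {k : RKHS.OfKernel G | ∃ (x : F) (h : H), k = L x h} =
      {k | ∃ (x : F) (h : H), RKHS.kerFun (RKHS.OfKernel G) x h = k} := by
    ext k
    exact ⟨fun ⟨x, h, e⟩ => ⟨x, h, e.symm⟩, fun ⟨x, h, e⟩ => ⟨x, h, e.symm⟩⟩
  rw [hset]
  exact hd

/-! ### Self-duality of von Neumann modules -/

/-- An operator `X : H → F ⊗ H` all of whose coefficients `L_y⋆ X` belong to `C` is approximated by
elements of `F`, on any finite set of vectors. -/
lemma IsInteriorTensor.exists_approx (hL : IsInteriorTensor ρ L) {X : H →L[ℂ] K}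
    (hX : ∀ y : F, ∃ c : C, ∀ g h : H, ⟪L y g, X h⟫_ℂ = ⟪g, ρ c h⟫_ℂ)
    {ι : Type*} [Fintype ι] (h : ι → H) {ε : ℝ} (hε : 0 < ε) :
    ∃ x : F, ∀ i, ‖X (h i) - L x (h i)‖ < ε := by
  classical
  let orbH : C →ₗ[ℂ] PiLp 2 (fun _ : ι => H) :=
    { toFun := fun c => WithLp.toLp 2 fun i => ρ c (h i)
      map_add' := fun a b => by ext i; simp
      map_smul' := fun a b => by ext i; simp }
  let orbK : F →ₗ[ℂ] PiLp 2 (fun _ : ι => K) :=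
    { toFun := fun x => WithLp.toLp 2 fun i => L x (h i)
      map_add' := fun a b => by ext i; simp
      map_smul' := fun a b => by ext i; simp }
  let Ln : F → PiLp 2 (fun _ : ι => H) →L[ℂ] PiLp 2 (fun _ : ι => K) := fun y =>
    ((PiLp.continuousLinearEquiv 2 ℂ (fun _ : ι => K)).symm :
        (ι → K) →L[ℂ] PiLp 2 (fun _ : ι => K)) ∘L
      (ContinuousLinearMap.pi fun i => L y ∘L ContinuousLinearMap.proj i) ∘L
        (PiLp.continuousLinearEquiv 2 ℂ (fun _ : ι => H) : PiLp 2 (fun _ : ι => H) →L[ℂ] (ι → H))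
  have hLn : ∀ y g i, Ln y g i = L y (g i) := fun y g i => rfl
  -- A density argument on a finite power: `Z` is the closed `C`-orbit of the tuple `h`, `W` the
  -- closure of the tuples `(x ⊗ hᵢ)`. Each amplified `L_y` maps `Z` into `W` and `Zᗮ` into `Wᗮ`,
  -- and the goal is that `X h` lies in `W`.
  let Z := (LinearMap.range orbH).topologicalClosure
  let W := (LinearMap.range orbK).topologicalClosure
  have hZc : IsClosed (Z : Set (PiLp 2 (fun _ : ι => H))) :=
    Submodule.isClosed_topologicalClosure _
  have hWc : IsClosed (W : Set (PiLp 2 (fun _ : ι => K))) :=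
    Submodule.isClosed_topologicalClosure _
  have : CompleteSpace Z := hZc.completeSpace_coe
  have : CompleteSpace W := hWc.completeSpace_coe
  have hLZ : ∀ y, ∀ g ∈ Z, Ln y g ∈ W := by
    intro y g hg
    refine map_mem_closure (Ln y).continuous hg ?_
    rintro _ ⟨c, rfl⟩
    refine ⟨MulOpposite.op c • y, ?_⟩
    ext i
    exact hL.apply_op_smul c y (h i)
  have hinner : ∀ y g c (v : PiLp 2 (fun _ : ι => K)), g ∈ Zᗮ →
      (∀ i, ⟪L y (g i), v i⟫_ℂ = ⟪g i, ρ c (h i)⟫_ℂ) → ⟪Ln y g, v⟫_ℂ = 0 := by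
    intro y g c v hg hv
    have h1 : ⟪orbH c, g⟫_ℂ = 0 :=
      (Submodule.mem_orthogonal _ _).mp hg _
        (Submodule.le_topologicalClosure _ (LinearMap.mem_range_self _ c))
    rw [← inner_conj_symm, map_eq_zero, PiLp.inner_apply] at h1
    rw [PiLp.inner_apply, ← h1]
    exact Finset.sum_congr rfl fun i _ => hv i
  have hLZ' : ∀ y, ∀ g ∈ Zᗮ, Ln y g ∈ Wᗮ := by
    intro y g hg
    rw [Submodule.orthogonal_closure, Submodule.mem_orthogonal']
    rintro _ ⟨x, rfl⟩
    exact hinner y g (ip C y x) _ hg fun i => hL.inner_eq _ _ _ _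
  let Xh : PiLp 2 (fun _ : ι => K) := WithLp.toLp 2 fun i => X (h i)
  have hXW : Xh ∈ W := by
    obtain ⟨p, hp, q, hq, hpq⟩ := W.exists_add_mem_mem_orthogonal Xh
    suffices hq0 : q = 0 by rw [hpq, hq0, add_zero]; exact hp
    -- The component `q` of `X h` in `Wᗮ` is orthogonal to all `L_y g`: on `Z` because the image is
    -- in `W`, on `Zᗮ` because the coefficient `L_y⋆ X` lies in `ρ(C)`.
    have hzero : ∀ y g, ⟪Ln y g, q⟫_ℂ = 0 := by
      intro y g
      obtain ⟨g₁, hg₁, g₂, hg₂, rfl⟩ := Z.exists_add_mem_mem_orthogonal g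
      have e1 : ⟪Ln y g₁, q⟫_ℂ = 0 := (Submodule.mem_orthogonal _ _).mp hq _ (hLZ y g₁ hg₁)
      have e2 : ⟪Ln y g₂, Xh⟫_ℂ = 0 := by
        obtain ⟨c, hc⟩ := hX y
        exact hinner y g₂ c Xh hg₂ fun i => hc _ _
      have e3 : ⟪Ln y g₂, p⟫_ℂ = 0 := (Submodule.mem_orthogonal' _ _).mp (hLZ' y g₂ hg₂) _ hp
      have e4 : q = Xh - p := by rw [hpq]; abel
      rw [map_add, inner_add_left, e1, zero_add, e4, inner_sub_right, e2, e3, sub_zero]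
    ext i
    refine hL.ext_inner fun y g => ?_
    have := hzero y (WithLp.toLp 2 (Pi.single i g))
    rw [PiLp.inner_apply, Finset.sum_eq_single i] at this
    · rw [hLn] at this
      simpa using this
    · intro j _ hj
      rw [hLn]
      simp [hj]
    · simp
  obtain ⟨_, ⟨x, rfl⟩, hx⟩ := Metric.mem_closure_iff.mp hXW ε hε
  refine ⟨x, fun i => ?_⟩
  rw [dist_eq_norm] at hx
  exact (PiLp.norm_apply_le (Xh - orbK x) i).trans_lt hx

/-- In a von Neumann module, every operator `H → F ⊗ H` with coefficients in `C` comes from an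
element of the module. -/
lemma IsInteriorTensor.exists_eq_of_isClosed (hL : IsInteriorTensor ρ L)
    (hcl : IsClosed (Set.range fun x : F =>
      ContinuousLinearMap.toPointwiseConvergenceCLM ℂ (RingHom.id ℂ) H K (L x)))
    {X : H →L[ℂ] K}
    (hX : ∀ y : F, ∃ c : C, ∀ g h : H, ⟪L y g, X h⟫_ℂ = ⟪g, ρ c h⟫_ℂ) :
    ∃ x : F, L x = X := by
  classical
  -- The approximants form a net indexed by finite sets of vectors and tolerances `1/(n+1)`; it
  -- converges strongly to `X`.
  have happ : ∀ p : Finset H × ℕ, ∃ x : F, ∀ h ∈ p.1, ‖X h - L x h‖ < 1 / (p.2 + 1 : ℝ) := by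
    intro p
    obtain ⟨x, hx⟩ := hL.exists_approx hX (fun i : p.1 => (i : H))
      (Nat.one_div_pos_of_nat (α := ℝ) (n := p.2))
    exact ⟨x, fun h hh => hx ⟨h, hh⟩⟩
  choose x hx using happ
  have hlim : Filter.Tendsto (fun p : Finset H × ℕ =>
      ContinuousLinearMap.toPointwiseConvergenceCLM ℂ (RingHom.id ℂ) H K (L (x p))) Filter.atTop
      (nhds (ContinuousLinearMap.toPointwiseConvergenceCLM ℂ (RingHom.id ℂ) H K X)) := by
    rw [PointwiseConvergenceCLM.tendsto_iff_forall_tendsto]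
    intro h
    rw [tendsto_iff_norm_sub_tendsto_zero]
    have h0 : Filter.Tendsto (fun p : Finset H × ℕ => 1 / (p.2 + 1 : ℝ)) Filter.atTop (nhds 0) :=
      tendsto_one_div_add_atTop_nhds_zero_nat.comp
        (by rw [← Filter.prod_atTop_atTop_eq]; exact Filter.tendsto_snd)
    refine squeeze_zero' (Filter.Eventually.of_forall fun p => norm_nonneg _) ?_ h0
    filter_upwards [Filter.eventually_ge_atTop (({h} : Finset H), 0)] with p hp
    have hmem : h ∈ p.1 := hp.1 (Finset.mem_singleton_self h)
    rw [norm_sub_rev]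
    exact (hx p h hmem).le
  obtain ⟨x₀, hx₀⟩ := hcl.mem_of_tendsto hlim (Filter.Eventually.of_forall fun p => ⟨x p, rfl⟩)
  exact ⟨x₀, hx₀⟩

end Lifting

end AlphaCPD

end

noncomputable section

namespace AlphaCPD

/-! ### Operators between interior tensor products that come from module maps -/

section Implementation

open ContinuousLinearMap (adjoint adjoint_inner_left adjoint_inner_right)

variable {C : Type*} [CStarAlgebra C] [PartialOrder C] [StarOrderedRing C]
variable {H : Type*} [NormedAddCommGroup H] [InnerProductSpace ℂ H] [CompleteSpace H]
variable {ρ : C →⋆ₐ[ℂ] (H →L[ℂ] H)}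
variable {F : Type*} [NormedAddCommGroup F] [NormedSpace ℂ F] [SMul Cᵐᵒᵖ F] [CStarModule Cᵐᵒᵖ F]
variable {F' : Type*} [NormedAddCommGroup F'] [NormedSpace ℂ F'] [SMul Cᵐᵒᵖ F']
  [CStarModule Cᵐᵒᵖ F']
variable {F'' : Type*} [NormedAddCommGroup F''] [NormedSpace ℂ F''] [SMul Cᵐᵒᵖ F'']
  [CStarModule Cᵐᵒᵖ F'']
variable {K : Type*} [NormedAddCommGroup K] [InnerProductSpace ℂ K] [CompleteSpace K]
variable {K' : Type*} [NormedAddCommGroup K'] [InnerProductSpace ℂ K'] [CompleteSpace K']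
variable {K'' : Type*} [NormedAddCommGroup K''] [InnerProductSpace ℂ K''] [CompleteSpace K'']
variable {L'' : F'' →ₗ[ℂ] (H →L[ℂ] K'')}
variable {L' : F' →ₗ[ℂ] (H →L[ℂ] K')} {L : F →ₗ[ℂ] (H →L[ℂ] K)}

/-- `V` is the operator `1 ⊗ w` on the interior tensor product. -/
def Amplifies (L : F →ₗ[ℂ] (H →L[ℂ] K)) (w : H →L[ℂ] H) (V : K →L[ℂ] K) : Prop :=
  ∀ x h, V (L x h) = L x (w h)

/-- `X` intertwines the operators `1 ⊗ w` for all `w` in the commutant of `ρ`. -/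
def CommutantLinear (ρ : C →⋆ₐ[ℂ] (H →L[ℂ] H)) (L : F →ₗ[ℂ] (H →L[ℂ] K))
    (L' : F' →ₗ[ℂ] (H →L[ℂ] K')) (X : K →L[ℂ] K') : Prop :=
  ∀ w : H →L[ℂ] H, (∀ c, Commute (ρ c) w) → ∀ (V : K →L[ℂ] K) (V' : K' →L[ℂ] K'),
    Amplifies L w V → Amplifies L' w V' → X ∘L V = V' ∘L X

/-- The range of `ρ` is closed under adjoints, so its commutant is too. -/
lemma commute_adjoint {w : H →L[ℂ] H} (hw : ∀ c, Commute (ρ c) w) (c : C) :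
    Commute (ρ c) (adjoint w) := by
  have h1 := (hw (star c)).star_star
  rwa [← map_star, star_star, ContinuousLinearMap.star_eq_adjoint] at h1

lemma Amplifies.adjoint (hL : IsInteriorTensor ρ L) {w : H →L[ℂ] H} (hw : ∀ c, Commute (ρ c) w)
    {V : K →L[ℂ] K} (hV : Amplifies L w V) : Amplifies L (adjoint w) (adjoint V) := by
  intro x h
  refine hL.ext_inner fun y g => ?_
  rw [adjoint_inner_right, hV, hL.inner_eq, hL.inner_eq]
  have h1 : ρ (ip C y x) (ContinuousLinearMap.adjoint w h) =
      ContinuousLinearMap.adjoint w (ρ (ip C y x) h) :=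
    DFunLike.congr_fun (commute_adjoint hw _).eq h
  rw [h1, adjoint_inner_right]

lemma Amplifies.unique (hL : IsInteriorTensor ρ L) {w : H →L[ℂ] H} {V V' : K →L[ℂ] K}
    (hV : Amplifies L w V) (hV' : Amplifies L w V') : V = V' :=
  hL.ext_clm fun x g => by rw [hV, hV']

lemma commutantLinear_of_lift (hL : IsInteriorTensor ρ L) {X : K →L[ℂ] K'} {S : F → F'}
    (hX : ∀ x h, X (L x h) = L' (S x) h) : CommutantLinear ρ L L' X := by
  intro w _ V V' hV hV'
  refine hL.ext_clm fun x g => ?_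
  rw [ContinuousLinearMap.comp_apply, ContinuousLinearMap.comp_apply, hV, hX, hX, hV']

/-- Commutant linearity quantifies over given amplifications, so composing needs one on the middle
space; `exists_amplification` supplies it. -/
lemma CommutantLinear.comp (hL' : IsInteriorTensor ρ L') {X : K →L[ℂ] K'} {Y : K' →L[ℂ] K''}
    (hY : CommutantLinear ρ L' L'' Y) (hX : CommutantLinear ρ L L' X) :
    CommutantLinear ρ L L'' (Y ∘L X) := by
  intro w hw V V'' hV hV''
  obtain ⟨V', hV'⟩ := hL'.exists_amplification hw
  rw [ContinuousLinearMap.comp_assoc, hX w hw V V' hV hV', ← ContinuousLinearMap.comp_assoc,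
    hY w hw V' V'' hV' hV'', ContinuousLinearMap.comp_assoc]

lemma CommutantLinear.adjoint (hL : IsInteriorTensor ρ L) (hL' : IsInteriorTensor ρ L')
    {X : K →L[ℂ] K'} (hX : CommutantLinear ρ L L' X) : CommutantLinear ρ L' L (adjoint X) := by
  intro w hw V' V hV' hV
  have h1 := hX _ (commute_adjoint hw) _ _ (hV.adjoint hL hw) (hV'.adjoint hL' hw)
  have h2 := congrArg ContinuousLinearMap.adjoint h1
  rw [ContinuousLinearMap.adjoint_comp, ContinuousLinearMap.adjoint_comp,
    ContinuousLinearMap.adjoint_adjoint, ContinuousLinearMap.adjoint_adjoint] at h2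
  exact h2.symm

/-- A self-map is commutant linear if it commutes with everything that commutes with a commutant
linear self-map. -/
lemma CommutantLinear.of_commute (hL : IsInteriorTensor ρ L) {X Y : K →L[ℂ] K}
    (hX : CommutantLinear ρ L L X) (h : ∀ V : K →L[ℂ] K, Commute X V → Commute Y V) :
    CommutantLinear ρ L L Y := by
  intro w hw V V' hV hV'
  obtain rfl := hV.unique hL hV'
  exact (h V (hX w hw V V hV hV)).eq

/-- The commutant of the commutant of `ρ` is the image of `ρ`. -/
lemma ActsAsVonNeumannAlgebra.exists_eq (hρ : ActsAsVonNeumannAlgebra ρ) {X : H →L[ℂ] H}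
    (hX : ∀ w : H →L[ℂ] H, (∀ c, Commute (ρ c) w) → w * X = X * w) : ∃ c, ρ c = X := by
  obtain ⟨W, hW⟩ := hρ.range_eq
  have h1 : X ∈ Set.centralizer (Set.centralizer (W : Set (H →L[ℂ] H))) := by
    intro w hw
    refine hX w fun c => ?_
    exact hw (ρ c) (hW ▸ Set.mem_range_self c)
  rw [W.centralizer_centralizer, hW] at h1
  exact h1

/-- Commutant linear operators into a von Neumann module are implemented by bounded maps. -/
lemma CommutantLinear.exists_map (hρ : ActsAsVonNeumannAlgebra ρ) (hL : IsInteriorTensor ρ L)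
    (hL' : IsInteriorTensor ρ L')
    (hcl : IsClosed (Set.range fun x : F' =>
      ContinuousLinearMap.toPointwiseConvergenceCLM ℂ (RingHom.id ℂ) H K' (L' x)))
    {X : K →L[ℂ] K'} (hX : CommutantLinear ρ L L' X) :
    ∃ T : F →L[ℂ] F', ‖T‖ ≤ ‖X‖ ∧ ∀ x h, L' (T x) h = X (L x h) := by
  have hex : ∀ x : F, ∃ y : F', L' y = X ∘L L x := by
    intro x
    refine hL'.exists_eq_of_isClosed hcl fun y => ?_
    -- The coefficient `L_y⋆ X L_x` commutes with the commutant of `ρ`, hence lies in `ρ(C)`;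
    -- self-duality then produces the value of the map at `x`.
    obtain ⟨c, hc⟩ := hρ.exists_eq (X := ContinuousLinearMap.adjoint (L' y) ∘L X ∘L L x) (by
      intro w hw
      obtain ⟨V, hV⟩ := hL.exists_amplification hw
      obtain ⟨V', hV'⟩ := hL'.exists_amplification hw
      have hXV := hX w hw V V' hV hV'
      ext h
      refine ext_inner_left ℂ fun g => ?_
      change ⟪g, w (ContinuousLinearMap.adjoint (L' y) (X (L x h)))⟫_ℂ =
        ⟪g, ContinuousLinearMap.adjoint (L' y) (X (L x (w h)))⟫_ℂ
      rw [adjoint_inner_right, ← hV x h]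
      have h1 : X (V (L x h)) = V' (X (L x h)) := DFunLike.congr_fun hXV _
      have h2 := Amplifies.adjoint hL' hw hV' y g
      rw [h1, ← adjoint_inner_left V', h2, ← adjoint_inner_right (L' y), adjoint_inner_left])
    refine ⟨c, fun g h => ?_⟩
    rw [hc, ← adjoint_inner_right]
    rfl
  choose T hT using hex
  have hinj := hL'.injective hρ.injective
  let T' : F →ₗ[ℂ] F' :=
    { toFun := T
      map_add' := fun x y => hinj (by
        rw [map_add, hT, hT, hT, map_add, ContinuousLinearMap.comp_add])
      map_smul' := fun a x => hinj (by
        rw [RingHom.id_apply, map_smul, hT, hT, map_smul, ContinuousLinearMap.comp_smul]) }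
  have hb : ∀ x, ‖T' x‖ ≤ ‖X‖ * ‖x‖ := fun x => by
    rw [← hL'.norm_apply hρ.injective, ← hL.norm_apply hρ.injective]
    change ‖L' (T x)‖ ≤ _
    rw [hT]
    exact ContinuousLinearMap.opNorm_comp_le _ _
  refine ⟨T'.mkContinuous ‖X‖ hb, LinearMap.mkContinuous_norm_le _ (norm_nonneg _) hb,
    fun x h => ?_⟩
  change L' (T x) h = _
  rw [hT]
  rfl

/-- Commutant linear operators between von Neumann modules are implemented by adjointable maps. -/
lemma CommutantLinear.exists_adjointable (hρ : ActsAsVonNeumannAlgebra ρ)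
    (hL : IsInteriorTensor ρ L) (hL' : IsInteriorTensor ρ L')
    (hcl : IsClosed (Set.range fun x : F =>
      ContinuousLinearMap.toPointwiseConvergenceCLM ℂ (RingHom.id ℂ) H K (L x)))
    (hcl' : IsClosed (Set.range fun x : F' =>
      ContinuousLinearMap.toPointwiseConvergenceCLM ℂ (RingHom.id ℂ) H K' (L' x)))
    {X : K →L[ℂ] K'} (hX : CommutantLinear ρ L L' X) :
    ∃ T : F →L[ℂ] F', IsAdjointable C T ∧ ‖T‖ ≤ ‖X‖ ∧ ∀ x h, L' (T x) h = X (L x h) := by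
  obtain ⟨T, hTn, hT⟩ := hX.exists_map hρ hL hL' hcl'
  obtain ⟨S, -, hS⟩ := (hX.adjoint hL hL').exists_map hρ hL' hL hcl
  refine ⟨T, ⟨S, fun x y => hρ.injective ?_⟩, hTn, hT⟩
  ext h
  refine ext_inner_left ℂ fun g => ?_
  rw [← hL'.inner_eq, ← hL.inner_eq, hT, hS, adjoint_inner_right]

end Implementation

/-! ### Averages of operators -/

section Average

variable {K K' : Type*} [NormedAddCommGroup K] [InnerProductSpace ℂ K] [CompleteSpace K]
  [NormedAddCommGroup K'] [InnerProductSpace ℂ K'] [CompleteSpace K']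

open Filter Topology

/-- Bounded sequences of vectors have weak limits along ultrafilters. -/
lemma exists_weak_limit (ω : Ultrafilter ℕ) {s : ℕ → K} {r : ℝ} (hs : ∀ n, ‖s n‖ ≤ r) :
    ∃ k : K, ∀ ξ, Tendsto (fun n => ⟪s n, ξ⟫_ℂ) ω (𝓝 ⟪k, ξ⟫_ℂ) := by
  let f : ℕ → WeakDual ℂ K := fun n => StrongDual.toWeakDual (InnerProductSpace.toDual ℂ K (s n))
  have hf : ∀ n, f n ∈ WeakDual.toStrongDual ⁻¹' Metric.closedBall (0 : StrongDual ℂ K) r := by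
    intro n
    rw [Set.mem_preimage, mem_closedBall_zero_iff]
    exact (LinearIsometryEquiv.norm_map (InnerProductSpace.toDual ℂ K) (s n)).trans_le (hs n)
  -- Banach–Alaoglu, after identifying vectors with functionals by the Riesz map.
  obtain ⟨g, -, hg⟩ := (WeakDual.isCompact_closedBall (0 : StrongDual ℂ K) r).ultrafilter_le_nhds
    (ω.map f) (by
      rw [le_principal_iff, Ultrafilter.mem_coe, Ultrafilter.mem_map]
      exact Filter.Eventually.of_forall hf)
  refine ⟨(InnerProductSpace.toDual ℂ K).symm (WeakDual.toStrongDual g), fun ξ => ?_⟩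
  rw [InnerProductSpace.toDual_symm_apply]
  have h1 : Tendsto f ω (𝓝 g) := hg
  exact ((WeakDual.eval_continuous ξ).tendsto g).comp h1

/-- Sequences of contractions have weak limits along ultrafilters. -/
lemma exists_weak_operator_limit (ω : Ultrafilter ℕ) {S : ℕ → K →L[ℂ] K'}
    (hS : ∀ n, ‖S n‖ ≤ 1) :
    ∃ A : K →L[ℂ] K', ‖A‖ ≤ 1 ∧
      ∀ η ξ, Tendsto (fun n => ⟪S n η, ξ⟫_ℂ) ω (𝓝 ⟪A η, ξ⟫_ℂ) := by
  have hbound : ∀ η n, ‖S n η‖ ≤ ‖η‖ := fun η n => by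
    simpa using (S n).le_of_opNorm_le (hS n) η
  choose A hA using fun η => exists_weak_limit ω (hbound η)
  have hA' : ∀ η k, (∀ ξ, Tendsto (fun n => ⟪S n η, ξ⟫_ℂ) ω (𝓝 ⟪k, ξ⟫_ℂ)) → A η = k :=
    fun η k h => ext_inner_right ℂ fun ξ => tendsto_nhds_unique (hA η ξ) (h ξ)
  let A' : K →ₗ[ℂ] K' :=
    { toFun := A
      map_add' := fun η η' => hA' _ _ fun ξ => by
        simp only [map_add, inner_add_left]
        exact (hA η ξ).add (hA η' ξ)
      map_smul' := fun a η => hA' _ _ fun ξ => by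
        simp only [map_smul, inner_smul_left, RingHom.id_apply]
        exact (hA η ξ).const_mul _ }
  have hb : ∀ η, ‖A' η‖ ≤ 1 * ‖η‖ := by
    intro η
    rw [one_mul]
    have h1 : ‖⟪A η, A η⟫_ℂ‖ ≤ ‖η‖ * ‖A η‖ :=
      le_of_tendsto (hA η (A η)).norm (Eventually.of_forall fun n =>
        (norm_inner_le_norm _ _).trans (mul_le_mul_of_nonneg_right (hbound η n) (norm_nonneg _)))
    rw [inner_self_eq_norm_sq_to_K, norm_pow, RCLike.norm_ofReal, abs_norm, sq] at h1
    rcases (norm_nonneg (A η)).eq_or_lt with h0 | h0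
    · exact h0.symm.le.trans (norm_nonneg _)
    · exact le_of_mul_le_mul_right h1 h0
  refine ⟨A'.mkContinuous 1 hb, LinearMap.mkContinuous_norm_le _ zero_le_one hb, fun η ξ => hA η ξ⟩

lemma norm_pow_le_one {U : K →L[ℂ] K} (hU : ‖U‖ ≤ 1) (k : ℕ) : ‖U ^ k‖ ≤ 1 := by
  induction k with
  | zero => exact ContinuousLinearMap.norm_id_le
  | succ k ih =>
    rw [pow_succ]
    exact (norm_mul_le _ _).trans (mul_le_one₀ ih (norm_nonneg _) hU)

/-- The averages of the operators `V ^ k A₀ U ^ k` accumulate weakly at a contraction `A` with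
`V A U = A`. -/
lemma exists_average {A₀ : K →L[ℂ] K'} (hA₀ : ‖A₀‖ ≤ 1) {U : K →L[ℂ] K} (hU : ‖U‖ ≤ 1)
    {V : K' →L[ℂ] K'} (hV : ‖V‖ ≤ 1) :
    ∃ A : K →L[ℂ] K', ‖A‖ ≤ 1 ∧ V ∘L A ∘L U = A ∧
      (∀ η ξ η' ξ', (∀ k, ⟪(V ^ k) (A₀ ((U ^ k) η)), ξ⟫_ℂ = ⟪(V ^ k) (A₀ ((U ^ k) η')), ξ'⟫_ℂ) →
        ⟪A η, ξ⟫_ℂ = ⟪A η', ξ'⟫_ℂ) ∧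
      ∀ η ξ z, (∀ k, ⟪(V ^ k) (A₀ ((U ^ k) η)), ξ⟫_ℂ = z) → ⟪A η, ξ⟫_ℂ = z := by
  let T : ℕ → K →L[ℂ] K' := fun k => (V ^ k) ∘L A₀ ∘L (U ^ k)
  have hT : ∀ k, ‖T k‖ ≤ 1 := by
    intro k
    have h1 : ‖A₀ ∘L (U ^ k)‖ ≤ 1 :=
      (ContinuousLinearMap.opNorm_comp_le _ _).trans
        (mul_le_one₀ hA₀ (norm_nonneg _) (norm_pow_le_one hU k))
    exact (ContinuousLinearMap.opNorm_comp_le _ _).trans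
      (mul_le_one₀ (norm_pow_le_one hV k) (norm_nonneg _) h1)
  have hTn : ∀ k η, ‖T k η‖ ≤ ‖η‖ := fun k η => by
    simpa using (T k).le_of_opNorm_le (hT k) η
  -- Cesàro means of `n + 1` terms, so that the mean of index `0` is also defined.
  let S : ℕ → K →L[ℂ] K' := fun n => ((n + 1 : ℝ)⁻¹ : ℂ) • ∑ k ∈ Finset.range (n + 1), T k
  have hSn : ∀ n, ‖S n‖ ≤ 1 := by
    intro n
    have h1 : ‖∑ k ∈ Finset.range (n + 1), T k‖ ≤ (n + 1 : ℝ) := by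
      refine (norm_sum_le_of_le _ fun k _ => hT k).trans ?_
      simp
    have h2 : ‖((n + 1 : ℝ)⁻¹ : ℂ)‖ = (n + 1 : ℝ)⁻¹ := by
      rw [norm_inv, Complex.norm_of_nonneg]
      positivity
    rw [norm_smul, h2, inv_mul_le_iff₀ (by positivity), mul_one]
    exact h1
  have hS : ∀ n η ξ, ⟪S n η, ξ⟫_ℂ =
      ((n + 1 : ℝ)⁻¹ : ℂ) * ∑ k ∈ Finset.range (n + 1), ⟪T k η, ξ⟫_ℂ := by
    intro n η ξ
    simp only [S, smul_apply, sum_apply, inner_smul_left, sum_inner]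
    simp
  obtain ⟨A, hA1, hA⟩ := exists_weak_operator_limit (Filter.hyperfilter ℕ) hSn
  refine ⟨A, hA1, ?_, ?_, ?_⟩
  · ext η
    refine ext_inner_right ℂ fun ξ => ?_
    change ⟪V (A (U η)), ξ⟫_ℂ = _
    rw [← ContinuousLinearMap.adjoint_inner_right]
    have h1 := hA (U η) (ContinuousLinearMap.adjoint V ξ)
    have h2 := (h1.sub (hA η ξ))
    -- As `V T_k U = T_{k+1}`, the difference telescopes to `(T_{n+1} - T_0)/(n+1)`, which tends to
    -- `0`.
    have h3 : ∀ n, ⟪S n (U η), ContinuousLinearMap.adjoint V ξ⟫_ℂ - ⟪S n η, ξ⟫_ℂ =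
        ((n + 1 : ℝ)⁻¹ : ℂ) * (⟪T (n + 1) η, ξ⟫_ℂ - ⟪T 0 η, ξ⟫_ℂ) := by
      intro n
      rw [hS, hS, ← mul_sub, ← Finset.sum_sub_distrib]
      have h4 : ∀ k, ⟪T k (U η), ContinuousLinearMap.adjoint V ξ⟫_ℂ = ⟪T (k + 1) η, ξ⟫_ℂ := by
        intro k
        rw [ContinuousLinearMap.adjoint_inner_right]
        simp only [T, ContinuousLinearMap.comp_apply]
        rw [pow_succ' V, pow_succ U]
        rfl
      simp only [h4]
      rw [Finset.sum_range_sub (fun k => ⟪T k η, ξ⟫_ℂ)]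
    have h5 : Tendsto (fun n : ℕ => ⟪S n (U η), ContinuousLinearMap.adjoint V ξ⟫_ℂ -
        ⟪S n η, ξ⟫_ℂ) (Filter.hyperfilter ℕ) (𝓝 0) := by
      refine Tendsto.mono_left ?_ Nat.hyperfilter_le_atTop
      have h6 : Tendsto (fun n : ℕ => 1 / (n + 1 : ℝ) * (‖η‖ * ‖ξ‖ + ‖η‖ * ‖ξ‖)) atTop (𝓝 0) := by
        simpa using tendsto_one_div_add_atTop_nhds_zero_nat.mul_const (‖η‖ * ‖ξ‖ + ‖η‖ * ‖ξ‖)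
      refine squeeze_zero_norm (fun n => ?_) h6
      have h2 : ‖((n + 1 : ℝ)⁻¹ : ℂ)‖ = 1 / (n + 1 : ℝ) := by
        rw [norm_inv, Complex.norm_of_nonneg, one_div]
        positivity
      have h7 : ∀ k, ‖⟪T k η, ξ⟫_ℂ‖ ≤ ‖η‖ * ‖ξ‖ := fun k =>
        (norm_inner_le_norm _ _).trans (mul_le_mul_of_nonneg_right (hTn k η) (norm_nonneg _))
      rw [h3, norm_mul, h2]
      gcongr
      exact (norm_sub_le _ _).trans (add_le_add (h7 _) (h7 _))
    exact sub_eq_zero.mp (tendsto_nhds_unique h2 h5)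
  · intro η ξ η' ξ' h
    have h1 : ∀ n, ⟪S n η, ξ⟫_ℂ = ⟪S n η', ξ'⟫_ℂ := fun n => by
      rw [hS, hS]
      exact congrArg _ (Finset.sum_congr rfl fun k _ => h k)
    have h2 := hA η ξ
    simp only [h1] at h2
    exact tendsto_nhds_unique h2 (hA η' ξ')
  · intro η ξ z h
    have h1 : ∀ n, ⟪S n η, ξ⟫_ℂ = z := fun n => by
      have h' : ∀ k, ⟪T k η, ξ⟫_ℂ = z := h
      simp only [hS, h']
      rw [Finset.sum_const, Finset.card_range]
      have : (n + 1 : ℂ) ≠ 0 := by exact_mod_cast n.succ_ne_zero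
      simp only [nsmul_eq_mul]
      push_cast
      field_simp
    have h2 := hA η ξ
    simp only [h1] at h2
    exact tendsto_nhds_unique h2 tendsto_const_nhds

end Average

end AlphaCPD

end

noncomputable section

namespace AlphaCPD

/-! ### S-correspondences on interior tensor products -/

section HilbertLift

open ContinuousLinearMap (adjoint adjoint_inner_left adjoint_inner_right)

variable {B : Type*} [CStarAlgebra B]
variable {C : Type*} [CStarAlgebra C] [PartialOrder C] [StarOrderedRing C]
variable {Ω : Type*} {α : B ≃⋆ₐ[ℂ] B} {κ : Ω → Ω → B →L[ℂ] C}
variable {F : Type*} [NormedAddCommGroup F] [NormedSpace ℂ F] [SMul Cᵐᵒᵖ F] [CStarModule Cᵐᵒᵖ F]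
variable {F' : Type*} [NormedAddCommGroup F'] [NormedSpace ℂ F'] [SMul Cᵐᵒᵖ F']
  [CStarModule Cᵐᵒᵖ F']
variable {D : SCorrespondence B C F} {i : Ω → F} {D' : SCorrespondence B C F'} {i' : Ω → F'}

lemma IsKolmogorov.U_π (hi : IsKolmogorov α κ D i) (b : B) (σ : Ω) :
    D.U (D.π b (i σ)) = D.π (α b) (i σ) := by
  have h := hi.U_apply b σ 1
  rwa [op_one_smul, op_one_smul] at h

lemma SCorrespondence.π_one_apply (D : SCorrespondence B C F) (x : F) : D.π 1 x = x := by
  rw [map_one, one_apply_eq_self]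

/-- This fixed-point property is why averaging over powers of `U` does not alter the coefficients at
the vectors `i(σ)`. -/
lemma IsKolmogorov.U_self (hi : IsKolmogorov α κ D i) (σ : Ω) : D.U (i σ) = i σ := by
  have h := hi.U_π 1 σ
  rw [D.π_one_apply, map_one α, D.π_one_apply] at h; exact h

lemma IsKolmogorov.U_symm_π (hi : IsKolmogorov α κ D i) (b : B) (σ : Ω) :
    D.U.symm (D.π b (i σ)) = D.π (α.symm b) (i σ) := by
  rw [ContinuousLinearEquiv.symm_apply_eq, hi.U_π, StarAlgEquiv.apply_symm_apply]

/-- Against cyclic vectors, `π(b)` has adjoint `π(α(b⋆))`: write `π(b') i(σ)` as `U π(α⁻¹(b'))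
i(σ)`, apply the `U`-representation identity, and push `U` back in. -/
lemma IsKolmogorov.ip_π_left (hi : IsKolmogorov α κ D i) (b b' : B) (x : F) (σ : Ω) :
    ip C (D.π b x) (D.π b' (i σ)) = ip C x (D.π (α (star b) * b') (i σ)) := by
  have h1 : D.π b' (i σ) = D.U (D.π (α.symm b') (i σ)) := by
    rw [hi.U_π, StarAlgEquiv.apply_symm_apply]
  rw [h1, D.uRep, ← mul_apply_eq_comp, ← map_mul, hi.U_π, map_mul,
    StarAlgEquiv.apply_symm_apply]

lemma IsKolmogorov.ip_π_π (hi : IsKolmogorov α κ D i) (b b' : B) (σ σ' : Ω) :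
    ip C (D.π b (i σ)) (D.π b' (i σ')) = κ σ σ' (α (star b) * b') := by
  rw [hi.ip_π_left, hi.kernel_eq]

lemma SCorrespondence.ip_U_U (D : SCorrespondence B C F) (x y : F) :
    ip C (D.U x) (D.U y) = ip C x y := by
  rw [D.unitary, ContinuousLinearEquiv.symm_apply_apply]

lemma SCorrespondence.isAdjointable_U (D : SCorrespondence B C F) :
    IsAdjointable C (D.U : F →L[ℂ] F) :=
  ⟨(D.U.symm : F →L[ℂ] F), D.unitary⟩

lemma SCorrespondence.norm_U_le (D : SCorrespondence B C F) : ‖(D.U : F →L[ℂ] F)‖ ≤ 1 := by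
  refine ContinuousLinearMap.opNorm_le_bound _ zero_le_one fun x => ?_
  rw [one_mul]
  have h1 : ‖D.U x‖ ^ 2 = ‖x‖ ^ 2 := by
    rw [norm_sq_eq_norm_ip (C := C), norm_sq_eq_norm_ip (C := C), D.ip_U_U]
  exact ((sq_eq_sq₀ (norm_nonneg _) (norm_nonneg _)).mp h1).le

variable {H : Type*} [NormedAddCommGroup H] [InnerProductSpace ℂ H] [CompleteSpace H]
variable {ρ : C →⋆ₐ[ℂ] (H →L[ℂ] H)}
variable {K : Type*} [NormedAddCommGroup K] [InnerProductSpace ℂ K] [CompleteSpace K]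
variable {K' : Type*} [NormedAddCommGroup K'] [InnerProductSpace ℂ K'] [CompleteSpace K']
variable {L' : F' →ₗ[ℂ] (H →L[ℂ] K')} {L : F →ₗ[ℂ] (H →L[ℂ] K)}

/-- The operators `π(b) ⊗ 1` and `U ⊗ 1` on the interior tensor product. -/
structure HilbertLift (D : SCorrespondence B C F) (L : F →ₗ[ℂ] (H →L[ℂ] K)) where
  P : B → K →L[ℂ] K
  U : K →L[ℂ] K
  P_apply : ∀ b x h, P b (L x h) = L (D.π b x) h
  U_apply : ∀ x h, U (L x h) = L (D.U x) h
  norm_U_le : ‖U‖ ≤ 1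

lemma IsInteriorTensor.nonempty_hilbertLift (hL : IsInteriorTensor ρ L)
    (D : SCorrespondence B C F) : Nonempty (HilbertLift D L) := by
  choose P _ hP using fun b =>
    hL.exists_lift hL (S := D.π b) fun c x => (D.adjointable b).map_op_smul c x
  obtain ⟨U, hU, hU'⟩ := hL.exists_lift hL (S := (D.U : F →L[ℂ] F))
    fun c x => D.isAdjointable_U.map_op_smul c x
  exact ⟨⟨P, U, hP, hU', hU.trans D.norm_U_le⟩⟩

namespace HilbertLift

variable (Q : HilbertLift D L) (Q' : HilbertLift D' L')

lemma adjoint_U_apply (hL : IsInteriorTensor ρ L) (x : F) (h : H) :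
    adjoint Q.U (L x h) = L (D.U.symm x) h :=
  hL.ext_inner fun y g => by
    rw [adjoint_inner_right, Q.U_apply, hL.inner_eq, hL.inner_eq, D.unitary]

lemma U_adjoint_U (hL : IsInteriorTensor ρ L) (k : K) : Q.U (adjoint Q.U k) = k := by
  have h1 : Q.U ∘L adjoint Q.U = ContinuousLinearMap.id ℂ K := hL.ext_clm fun x g => by
    rw [ContinuousLinearMap.comp_apply, Q.adjoint_U_apply hL, Q.U_apply,
      ContinuousLinearEquiv.apply_symm_apply, ContinuousLinearMap.id_apply]
  exact DFunLike.congr_fun h1 k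

lemma adjoint_U_U (hL : IsInteriorTensor ρ L) (k : K) : adjoint Q.U (Q.U k) = k := by
  have h1 : adjoint Q.U ∘L Q.U = ContinuousLinearMap.id ℂ K := hL.ext_clm fun x g => by
    rw [ContinuousLinearMap.comp_apply, Q.U_apply, Q.adjoint_U_apply hL,
      ContinuousLinearEquiv.symm_apply_apply, ContinuousLinearMap.id_apply]
  exact DFunLike.congr_fun h1 k

/-- Since `U` is unitary, this gives `P(b)⋆ = U P(b⋆) U⋆`: whatever intertwines `P`, `U` and `U⋆`
also intertwines `P⋆`. -/
lemma adjoint_P_U (hL : IsInteriorTensor ρ L) (b : B) (k : K) :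
    adjoint (Q.P b) (Q.U k) = Q.U (Q.P (star b) k) := by
  have h1 : adjoint (Q.P b) ∘L Q.U = Q.U ∘L Q.P (star b) := hL.ext_clm fun x g => by
    refine hL.ext_inner fun y f => ?_
    rw [ContinuousLinearMap.comp_apply, ContinuousLinearMap.comp_apply, adjoint_inner_right,
      Q.U_apply, Q.P_apply, Q.P_apply, Q.U_apply, hL.inner_eq, hL.inner_eq, D.uRep]
  exact DFunLike.congr_fun h1 k

lemma adjoint_P_apply (hL : IsInteriorTensor ρ L) (hi : IsKolmogorov α κ D i) (b b' : B) (σ : Ω)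
    (h : H) :
    adjoint (Q.P b) (L (D.π b' (i σ)) h) = L (D.π (α (star b) * b') (i σ)) h :=
  hL.ext_inner fun y g => by
    rw [adjoint_inner_right, Q.P_apply, hL.inner_eq, hL.inner_eq, hi.ip_π_left]

lemma commutantLinear_U (hL : IsInteriorTensor ρ L) : CommutantLinear ρ L L Q.U :=
  commutantLinear_of_lift hL Q.U_apply

/-- Two Kolmogorov decompositions of the same kernel are related by an equivariant partial
isometry. -/
structure Intertwines (α : B ≃⋆ₐ[ℂ] B) (W : K →L[ℂ] K') : Prop where
  norm_le : ‖W‖ ≤ 1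
  map_U : ∀ k, W (Q.U k) = Q'.U (W k)
  map_P : ∀ b k, W (Q.P b k) = Q'.P b (W k)
  adjoint_map_P : ∀ b k, adjoint W (Q'.P b k) = Q.P b (adjoint W k)
  map_U_P : ∀ b k, W (Q.U (Q.P b k)) = W (Q.P (α b) (Q.U k))
  adjoint_U_P : ∀ b k,
    adjoint Q.U (Q.P (α b) (adjoint W k)) = Q.P b (adjoint Q.U (adjoint W k))

end HilbertLift

/-- The vectors `π(b) i(σ) ⊗ h` have a Gram matrix determined by `κ`, and `U`, `U⋆`, `P(b)`, `P(b)⋆`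
permute them by formulas in `B` and `α` alone. The covariance `U P(b) = P(α b) U` is known only on
their span, hence the two relations in which `W` or `W⋆` cuts down to it. -/
lemma exists_intertwiner (hL : IsInteriorTensor ρ L) (hL' : IsInteriorTensor ρ L')
    (Q : HilbertLift D L) (Q' : HilbertLift D' L')
    (hi : IsKolmogorov α κ D i) (hi' : IsKolmogorov α κ D' i') :
    ∃ W : K →L[ℂ] K', Q.Intertwines Q' α W ∧ CommutantLinear ρ L L' W ∧
      ∀ b σ h, W (L (D.π b (i σ)) h) = L' (D'.π b (i' σ)) h := by
  let g : B × Ω × H → K := fun j => L (D.π j.1 (i j.2.1)) j.2.2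
  let g' : B × Ω × H → K' := fun j => L' (D'.π j.1 (i' j.2.1)) j.2.2
  obtain ⟨W, hWn, hW, hW0⟩ := exists_partialIsometry g g' fun j j' => by
    rw [hL.inner_eq, hL'.inner_eq, hi.ip_π_π, hi'.ip_π_π]
  have hU : ∀ j, Q.U (g j) = g (α j.1, j.2) := fun j => by
    simp only [g]; rw [Q.U_apply, hi.U_π]
  have hU' : ∀ j, Q'.U (g' j) = g' (α j.1, j.2) := fun j => by
    simp only [g']; rw [Q'.U_apply, hi'.U_π]
  have hV : ∀ j, adjoint Q.U (g j) = g (α.symm j.1, j.2) := fun j => by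
    simp only [g]; rw [Q.adjoint_U_apply hL, hi.U_symm_π]
  have hP : ∀ b j, Q.P b (g j) = g (b * j.1, j.2) := fun b j => by
    simp only [g]; rw [Q.P_apply, map_mul]; rfl
  have hP' : ∀ b j, Q'.P b (g' j) = g' (b * j.1, j.2) := fun b j => by
    simp only [g']; rw [Q'.P_apply, map_mul]; rfl
  have hPs : ∀ b j, adjoint (Q.P b) (g j) = g (α (star b) * j.1, j.2) := fun b j =>
    Q.adjoint_P_apply hL hi b j.1 j.2.1 j.2.2
  have hPs' : ∀ b j, adjoint (Q'.P b) (g' j) = g' (α (star b) * j.1, j.2) := fun b j =>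
    Q'.adjoint_P_apply hL' hi' b j.1 j.2.1 j.2.2
  have eU : W ∘L Q.U = Q'.U ∘L W := partialIsometry_intertwines hW hW0 hU hU' hV
  have eP : ∀ b, W ∘L Q.P b = Q'.P b ∘L W := fun b =>
    partialIsometry_intertwines hW hW0 (hP b) (hP' b) (hPs b)
  have ePs : ∀ b, W ∘L adjoint (Q.P b) = adjoint (Q'.P b) ∘L W := fun b =>
    partialIsometry_intertwines hW hW0 (hPs b) (hPs' b) fun j => by
      rw [ContinuousLinearMap.adjoint_adjoint]; exact hP b j
  have eUP : ∀ b, W ∘L (Q.P (α b) ∘L Q.U) = (Q'.U ∘L Q'.P b) ∘L W := fun b =>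
    partialIsometry_intertwines (θ := fun j => (α b * α j.1, j.2))
      (θ' := fun j => (α.symm (α (star (α b)) * j.1), j.2)) hW hW0
      (fun j => by rw [ContinuousLinearMap.comp_apply, hU, hP])
      (fun j => by rw [ContinuousLinearMap.comp_apply, hP', hU', map_mul])
      fun j => by
        rw [ContinuousLinearMap.adjoint_comp, ContinuousLinearMap.comp_apply, hPs, hV]
  have eUPs : ∀ b, W ∘L (adjoint (Q.P (α b)) ∘L Q.U) = (Q'.U ∘L adjoint (Q'.P b)) ∘L W :=
    fun b => partialIsometry_intertwines (θ := fun j => (α (α (star b)) * α j.1, j.2))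
      (θ' := fun j => (α.symm (α b * j.1), j.2)) hW hW0
      (fun j => by rw [ContinuousLinearMap.comp_apply, hU, hPs, ← map_star α b])
      (fun j => by rw [ContinuousLinearMap.comp_apply, hPs', hU', map_mul])
      fun j => by
        rw [ContinuousLinearMap.adjoint_comp, ContinuousLinearMap.adjoint_adjoint,
          ContinuousLinearMap.comp_apply, hP, hV]
  have eU1 : ∀ k, W (Q.U k) = Q'.U (W k) := fun k => DFunLike.congr_fun eU k
  have eP1 : ∀ b k, W (Q.P b k) = Q'.P b (W k) := fun b k => DFunLike.congr_fun (eP b) k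
  have ePs1 : ∀ b k, W (adjoint (Q.P b) k) = adjoint (Q'.P b) (W k) :=
    fun b k => DFunLike.congr_fun (ePs b) k
  have eUP1 : ∀ b k, W (Q.P (α b) (Q.U k)) = Q'.U (Q'.P b (W k)) :=
    fun b k => DFunLike.congr_fun (eUP b) k
  have eUPs1 : ∀ b k, W (adjoint (Q.P (α b)) (Q.U k)) = Q'.U (adjoint (Q'.P b) (W k)) :=
    fun b k => DFunLike.congr_fun (eUPs b) k
  refine ⟨W, ⟨hWn, eU1, eP1, fun b k => ?_, fun b k => ?_, fun b k => ?_⟩, ?_,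
    fun b σ h => hW (b, σ, h)⟩
  · refine ext_inner_right ℂ fun ξ => ?_
    rw [adjoint_inner_left, ← adjoint_inner_right, ← ePs1, ← adjoint_inner_left W,
      adjoint_inner_right]
  · rw [eU1, eP1, eUP1]
  · refine ext_inner_right ℂ fun ξ => ?_
    rw [adjoint_inner_left, ← adjoint_inner_right (Q.P (α b)), adjoint_inner_left W, eUPs1,
      ← adjoint_inner_right (Q.P b), adjoint_inner_left Q.U, adjoint_inner_left W, eU1, ePs1]
  · intro w hw V V' hV1 hV1'
    have hVs := hV1.adjoint hL hw
    exact partialIsometry_intertwines (θ := fun j => (j.1, j.2.1, w j.2.2))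
      (θ' := fun j => (j.1, j.2.1, adjoint w j.2.2)) hW hW0 (fun j => hV1 _ _)
      (fun j => hV1' _ _) (fun j => hVs _ _)

end HilbertLift

end AlphaCPD

end

noncomputable section

namespace AlphaCPD

/-! ### Transfer of bilinear contractions between Kolmogorov decompositions -/

section Transfer

open ContinuousLinearMap (adjoint adjoint_inner_left adjoint_inner_right)

variable {B : Type*} [CStarAlgebra B]
variable {C : Type*} [CStarAlgebra C] [PartialOrder C] [StarOrderedRing C]
variable {Ω : Type*} {α : B ≃⋆ₐ[ℂ] B} {κ₁ κ₂ : Ω → Ω → B →L[ℂ] C}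
variable {F₁ : Type*} [NormedAddCommGroup F₁] [NormedSpace ℂ F₁] [SMul Cᵐᵒᵖ F₁]
  [CStarModule Cᵐᵒᵖ F₁]
variable {F₂ : Type*} [NormedAddCommGroup F₂] [NormedSpace ℂ F₂] [SMul Cᵐᵒᵖ F₂]
  [CStarModule Cᵐᵒᵖ F₂]
variable {E₁ : Type*} [NormedAddCommGroup E₁] [NormedSpace ℂ E₁] [SMul Cᵐᵒᵖ E₁]
  [CStarModule Cᵐᵒᵖ E₁]
variable {E₂ : Type*} [NormedAddCommGroup E₂] [NormedSpace ℂ E₂] [SMul Cᵐᵒᵖ E₂]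
  [CStarModule Cᵐᵒᵖ E₂]
variable {D₁ : SCorrespondence B C F₁} {i₁ : Ω → F₁} {D₂ : SCorrespondence B C F₂} {i₂ : Ω → F₂}
variable {G₁ : SCorrespondence B C E₁} {j₁ : Ω → E₁} {G₂ : SCorrespondence B C E₂} {j₂ : Ω → E₂}
variable {H : Type*} [NormedAddCommGroup H] [InnerProductSpace ℂ H] [CompleteSpace H]
variable {ρ : C →⋆ₐ[ℂ] (H →L[ℂ] H)}
variable {K₁ : Type*} [NormedAddCommGroup K₁] [InnerProductSpace ℂ K₁] [CompleteSpace K₁]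
variable {K₂ : Type*} [NormedAddCommGroup K₂] [InnerProductSpace ℂ K₂] [CompleteSpace K₂]
variable {N₁ : Type*} [NormedAddCommGroup N₁] [InnerProductSpace ℂ N₁] [CompleteSpace N₁]
variable {N₂ : Type*} [NormedAddCommGroup N₂] [InnerProductSpace ℂ N₂] [CompleteSpace N₂]
variable {L₁ : F₁ →ₗ[ℂ] (H →L[ℂ] K₁)} {L₂ : F₂ →ₗ[ℂ] (H →L[ℂ] K₂)}
variable {Λ₁ : E₁ →ₗ[ℂ] (H →L[ℂ] N₁)} {Λ₂ : E₂ →ₗ[ℂ] (H →L[ℂ] N₂)}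

/-- A bilinear contraction between two Kolmogorov decompositions is transferred, on the level of
Hilbert spaces, to any other pair of Kolmogorov decompositions, and can be made to intertwine the
unitaries by averaging. -/
lemma exists_equivariant_contraction (hL₁ : IsInteriorTensor ρ L₁) (hL₂ : IsInteriorTensor ρ L₂)
    (hΛ₁ : IsInteriorTensor ρ Λ₁) (hΛ₂ : IsInteriorTensor ρ Λ₂)
    (Q₁ : HilbertLift D₁ L₁) (Q₂ : HilbertLift D₂ L₂)
    (hi₁ : IsKolmogorov α κ₁ D₁ i₁) (hi₂ : IsKolmogorov α κ₂ D₂ i₂)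
    (hj₁ : IsKolmogorov α κ₁ G₁ j₁) (hj₂ : IsKolmogorov α κ₂ G₂ j₂)
    {T : E₂ →L[ℂ] E₁} (hT : IsAdjointableBilinear G₂ G₁ T) (hTn : ‖T‖ ≤ 1) :
    ∃ A : K₂ →L[ℂ] K₁, ‖A‖ ≤ 1 ∧ CommutantLinear ρ L₂ L₁ A ∧
      (∀ b k, A (Q₂.P b k) = Q₁.P b (A k)) ∧ (∀ k, A (Q₂.U k) = Q₁.U (A k)) ∧
      ∀ σ σ' h g, ⟪A (L₂ (i₂ σ) h), L₁ (i₁ σ') g⟫_ℂ = ⟪Λ₁ (T (j₂ σ)) h, Λ₁ (j₁ σ') g⟫_ℂ := by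
  obtain ⟨R₁⟩ := hΛ₁.nonempty_hilbertLift G₁
  obtain ⟨R₂⟩ := hΛ₂.nonempty_hilbertLift G₂
  obtain ⟨W₁, hW₁, hcW₁, hgW₁⟩ := exists_intertwiner hL₁ hΛ₁ Q₁ R₁ hi₁ hj₁
  obtain ⟨W₂, hW₂, hcW₂, hgW₂⟩ := exists_intertwiner hL₂ hΛ₂ Q₂ R₂ hi₂ hj₂
  obtain ⟨Y, hYn, hY⟩ := hΛ₂.exists_lift hΛ₁ (S := T) hT.map_right
  have hYP : ∀ b k, Y (R₂.P b k) = R₁.P b (Y k) := fun b k => by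
    have h1 : Y ∘L R₂.P b = R₁.P b ∘L Y := hΛ₂.ext_clm fun x g => by
      rw [ContinuousLinearMap.comp_apply, ContinuousLinearMap.comp_apply, R₂.P_apply, hY, hY,
        R₁.P_apply, hT.map_left]
    exact DFunLike.congr_fun h1 k
  have hYc : CommutantLinear ρ Λ₂ Λ₁ Y := commutantLinear_of_lift hΛ₂ hY
  let A₀ : K₂ →L[ℂ] K₁ := adjoint W₁ ∘L Y ∘L W₂
  have hA₀n : ‖A₀‖ ≤ 1 := by
    have h1 : ‖Y ∘L W₂‖ ≤ 1 := (ContinuousLinearMap.opNorm_comp_le _ _).trans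
      (mul_le_one₀ (hYn.trans hTn) (norm_nonneg _) hW₂.norm_le)
    refine (ContinuousLinearMap.opNorm_comp_le _ _).trans (mul_le_one₀ ?_ (norm_nonneg _) h1)
    rw [LinearIsometryEquiv.norm_map]
    exact hW₁.norm_le
  have hVn : ‖adjoint Q₁.U‖ ≤ 1 := by
    rw [LinearIsometryEquiv.norm_map]
    exact Q₁.norm_U_le
  obtain ⟨A, hAn, hAU, hAeq, hAval⟩ := exists_average hA₀n Q₂.norm_U_le hVn
  -- These are the terms averaged into `A`; what is shown for each of them passes to `A`.
  let S : ℕ → K₂ →L[ℂ] K₁ := fun k => (adjoint Q₁.U ^ k) ∘L A₀ ∘L (Q₂.U ^ k)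
  have hS0 : S 0 = A₀ := by ext k; rfl
  have hSs : ∀ n, S (n + 1) = adjoint Q₁.U ∘L S n ∘L Q₂.U := by
    intro n
    ext k
    simp only [S]
    rw [pow_succ', pow_succ]
    rfl
  have hVW : ∀ k, adjoint Q₁.U (adjoint W₁ k) = adjoint W₁ (adjoint R₁.U k) := fun k =>
    ext_inner_right ℂ fun ξ => by
      rw [adjoint_inner_left, adjoint_inner_left, adjoint_inner_left, adjoint_inner_left,
        hW₁.map_U]
  -- Every term still begins with `W₂` and ends with `W₁⋆`, so covariance, valid only on the cyclic
  -- parts, may be applied on both sides.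
  have hSfac : ∀ n, ∃ Z : N₂ →L[ℂ] N₁, ∀ k, S n k = adjoint W₁ (Z (W₂ k)) := by
    intro n
    induction n with
    | zero => exact ⟨Y, fun k => by rw [hS0]; rfl⟩
    | succ n ih =>
      obtain ⟨Z, hZ⟩ := ih
      refine ⟨adjoint R₁.U ∘L Z ∘L R₂.U, fun k => ?_⟩
      rw [hSs, ContinuousLinearMap.comp_apply, ContinuousLinearMap.comp_apply, hZ, hVW,
        hW₂.map_U]
      rfl
  have hSP : ∀ n b k, S n (Q₂.P b k) = Q₁.P b (S n k) := by
    intro n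
    induction n with
    | zero =>
      intro b k
      rw [hS0]
      change adjoint W₁ (Y (W₂ (Q₂.P b k))) = Q₁.P b (adjoint W₁ (Y (W₂ k)))
      rw [hW₂.map_P, hYP, hW₁.adjoint_map_P]
    | succ n ih =>
      intro b k
      obtain ⟨Z, hZ⟩ := hSfac n
      rw [hSs]
      change adjoint Q₁.U (S n (Q₂.U (Q₂.P b k))) = Q₁.P b (adjoint Q₁.U (S n (Q₂.U k)))
      have h1 : S n (Q₂.U (Q₂.P b k)) = S n (Q₂.P (α b) (Q₂.U k)) := by
        rw [hZ, hZ, hW₂.map_U_P]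
      rw [h1, ih, hZ, hW₁.adjoint_U_P]
  have hSc : ∀ n, CommutantLinear ρ L₂ L₁ (S n) := by
    intro n
    induction n with
    | zero =>
      rw [hS0]
      exact (hcW₁.adjoint hL₁ hΛ₁).comp hΛ₁ (hYc.comp hΛ₂ hcW₂)
    | succ n ih =>
      rw [hSs]
      exact ((Q₁.commutantLinear_U hL₁).adjoint hL₁ hL₁).comp hL₁
        (ih.comp hL₂ (Q₂.commutantLinear_U hL₂))
  have hgen : ∀ (X₂ : K₂ →L[ℂ] K₂) (X₁ : K₁ →L[ℂ] K₁), (∀ n k, S n (X₂ k) = X₁ (S n k)) →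
      ∀ k, A (X₂ k) = X₁ (A k) := by
    intro X₂ X₁ h k
    refine ext_inner_right ℂ fun ξ => ?_
    rw [← adjoint_inner_right X₁]
    refine hAeq _ _ _ _ fun n => ?_
    rw [adjoint_inner_right]
    exact congrArg (fun y => ⟪y, ξ⟫_ℂ) (h n k)
  refine ⟨A, hAn, ?_, fun b => hgen _ _ fun n => hSP n b, fun k => ?_, fun σ σ' h g => ?_⟩
  · intro w hw V V' hV hV'
    ext k
    exact hgen V V' (fun n k => DFunLike.congr_fun (hSc n w hw V V' hV hV') k) k
  · have h1 : adjoint Q₁.U (A (Q₂.U k)) = A k := DFunLike.congr_fun hAU k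
    rw [← h1, Q₁.U_adjoint_U hL₁]
  · have hfix₂ : ∀ n, (Q₂.U ^ n) (L₂ (i₂ σ) h) = L₂ (i₂ σ) h := by
      have h1 : Q₂.U (L₂ (i₂ σ) h) = L₂ (i₂ σ) h := by
        rw [Q₂.U_apply, hi₂.U_self]
      intro n
      induction n with
      | zero => rfl
      | succ n ih => rw [pow_succ, mul_apply_eq_comp, h1, ih]
    have hfix₁ : ∀ n ξ, ⟪(adjoint Q₁.U ^ n) ξ, L₁ (i₁ σ') g⟫_ℂ = ⟪ξ, L₁ (i₁ σ') g⟫_ℂ := by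
      have h1 : Q₁.U (L₁ (i₁ σ') g) = L₁ (i₁ σ') g := by
        rw [Q₁.U_apply, hi₁.U_self]
      intro n
      induction n with
      | zero => intro ξ; rfl
      | succ n ih =>
        intro ξ
        rw [pow_succ, mul_apply_eq_comp, ih, adjoint_inner_left, h1]
    refine hAval _ _ _ fun n => ?_
    rw [hfix₁, hfix₂]
    change ⟪adjoint W₁ (Y (W₂ (L₂ (i₂ σ) h))), _⟫_ℂ = _
    have e₁ := hgW₁ 1 σ' g
    have e₂ := hgW₂ 1 σ h
    rw [D₁.π_one_apply, G₁.π_one_apply] at e₁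
    rw [D₂.π_one_apply, G₂.π_one_apply] at e₂
    rw [adjoint_inner_left, e₁, e₂, hY]

/-- The positive square root of `1 - A⋆ A` for a contraction `A`. -/
lemma exists_defect {A : K₂ →L[ℂ] K₁} (hA : ‖A‖ ≤ 1) :
    ∃ X : K₂ →L[ℂ] K₂, (∀ k k', ⟪X k, X k'⟫_ℂ = ⟪k, k'⟫_ℂ - ⟪A k, A k'⟫_ℂ) ∧
      ∀ V : K₂ →L[ℂ] K₂, Commute (adjoint A ∘L A) V → Commute X V := by
  have hpos : 0 ≤ adjoint A ∘L A := by
    rw [ContinuousLinearMap.nonneg_iff_isPositive]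
    exact ContinuousLinearMap.isPositive_adjoint_comp_self A
  have hle : adjoint A ∘L A ≤ 1 := by
    rw [← CStarAlgebra.norm_le_one_iff_of_nonneg _ hpos, ContinuousLinearMap.norm_adjoint_comp_self]
    exact mul_le_one₀ hA (norm_nonneg _) hA
  have hnn : 0 ≤ 1 - adjoint A ∘L A := sub_nonneg.mpr hle
  refine ⟨CFC.sqrt (1 - adjoint A ∘L A), fun k k' => ?_, fun V hV => ?_⟩
  · have hsa : adjoint (CFC.sqrt (1 - adjoint A ∘L A)) = CFC.sqrt (1 - adjoint A ∘L A) :=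
      (CFC.sqrt_nonneg (1 - adjoint A ∘L A)).isSelfAdjoint
    rw [← adjoint_inner_right, hsa, ← mul_apply_eq_comp,
      CFC.sqrt_mul_sqrt_self _ hnn, ← adjoint_inner_right A, ← inner_sub_right]
    rfl
  -- The square root lies in the functional calculus of `1 - A⋆A`, so it commutes with whatever
  -- commutes with `A⋆A`.
  · exact ((Commute.one_left V).sub_left hV).cfcₙ_nnreal _

/-- Transfer of a bilinear contraction to a pair of Kolmogorov decompositions on von Neumann
modules, together with its defect operator. -/
lemma exists_transfer (hρ : ActsAsVonNeumannAlgebra ρ)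
    (hF₁ : IsVonNeumannModule ρ F₁) (hF₂ : IsVonNeumannModule ρ F₂)
    (hi₁ : IsKolmogorov α κ₁ D₁ i₁) (hi₂ : IsKolmogorov α κ₂ D₂ i₂)
    (hj₁ : IsKolmogorov α κ₁ G₁ j₁) (hj₂ : IsKolmogorov α κ₂ G₂ j₂)
    {T : E₂ →L[ℂ] E₁} (hT : IsAdjointableBilinear G₂ G₁ T) (hTn : ‖T‖ ≤ 1) :
    ∃ (T' : F₂ →L[ℂ] F₁) (S : F₂ →L[ℂ] F₂), IsAdjointableBilinear D₂ D₁ T' ∧ ‖T'‖ ≤ 1 ∧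
      (∀ x, T' (D₂.U x) = D₁.U (T' x)) ∧
      IsAdjointableBilinear D₂ D₂ S ∧ (∀ x, S (D₂.U x) = D₂.U (S x)) ∧
      (∀ x y, ip C (T' x) (T' y) + ip C (S x) (S y) = ip C x y) ∧
      ∀ σ σ', ip C (i₁ σ) (T' (i₂ σ')) = ip C (j₁ σ) (T (j₂ σ')) := by
  obtain ⟨K₁, _, _, _, L₁, hL₁, hcl₁⟩ := hF₁
  obtain ⟨K₂, _, _, _, L₂, hL₂, hcl₂⟩ := hF₂
  obtain ⟨N₁, _, _, _, Λ₁, hΛ₁⟩ := exists_isInteriorTensor (F := E₁) ρ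
  obtain ⟨N₂, _, _, _, Λ₂, hΛ₂⟩ := exists_isInteriorTensor (F := E₂) ρ
  obtain ⟨Q₁⟩ := hL₁.nonempty_hilbertLift D₁
  obtain ⟨Q₂⟩ := hL₂.nonempty_hilbertLift D₂
  obtain ⟨A, hAn, hAc, hAP, hAU, hAval⟩ := exists_equivariant_contraction hL₁ hL₂ hΛ₁ hΛ₂ Q₁ Q₂
    hi₁ hi₂ hj₁ hj₂ hT hTn
  have hAV : ∀ k, A (adjoint Q₂.U k) = adjoint Q₁.U (A k) := fun k => by
    conv_rhs => rw [← Q₂.U_adjoint_U hL₂ k, hAU, Q₁.adjoint_U_U hL₁]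
  -- Here averaging pays off: from `P(b)⋆ = U P(b⋆) U⋆`, intertwining `U` gives intertwining of
  -- `P⋆`, so `A⋆A`, and with it the defect, commutes with `P` and `U`.
  have hAPs : ∀ b k, A (adjoint (Q₂.P b) k) = adjoint (Q₁.P b) (A k) := fun b k => by
    conv_lhs => rw [← Q₂.U_adjoint_U hL₂ k, Q₂.adjoint_P_U hL₂, hAU, hAP, hAV]
    rw [← Q₁.adjoint_P_U hL₁, Q₁.U_adjoint_U hL₁]
  have hadj : ∀ (X₂ : K₂ →L[ℂ] K₂) (X₁ : K₁ →L[ℂ] K₁), (∀ k, A (X₂ k) = X₁ (A k)) →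
      (∀ k, A (adjoint X₂ k) = adjoint X₁ (A k)) → Commute (adjoint A ∘L A) X₂ := by
    intro X₂ X₁ h h'
    ext k
    refine ext_inner_right ℂ fun ξ => ?_
    change ⟪adjoint A (A (X₂ k)), ξ⟫_ℂ = ⟪X₂ (adjoint A (A k)), ξ⟫_ℂ
    rw [adjoint_inner_left, h, ← adjoint_inner_right X₁, ← h', ← adjoint_inner_left A,
      adjoint_inner_right]
  obtain ⟨X, hXin, hXc⟩ := exists_defect hAn
  have hXl : CommutantLinear ρ L₂ L₂ X := ((hAc.adjoint hL₂ hL₁).comp hL₁ hAc).of_commute hL₂ hXc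
  have hXP : ∀ b k, X (Q₂.P b k) = Q₂.P b (X k) := fun b k =>
    DFunLike.congr_fun (hXc _ (hadj _ _ (hAP b) (hAPs b))).eq k
  have hXU : ∀ k, X (Q₂.U k) = Q₂.U (X k) := fun k =>
    DFunLike.congr_fun (hXc _ (hadj _ _ hAU hAV)).eq k
  obtain ⟨T', hT'a, hT'n, hT'⟩ := hAc.exists_adjointable hρ hL₂ hL₁ hcl₂ hcl₁
  obtain ⟨S, hSa, -, hS⟩ := hXl.exists_adjointable hρ hL₂ hL₂ hcl₂ hcl₂
  have inj₁ := hL₁.injective hρ.injective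
  have inj₂ := hL₂.injective hρ.injective
  refine ⟨T', S, ⟨hT'a, fun b x => inj₁ ?_, hT'a.map_op_smul⟩, hT'n.trans hAn, fun x => inj₁ ?_,
    ⟨hSa, fun b x => inj₂ ?_, hSa.map_op_smul⟩, fun x => inj₂ ?_, fun x y => hρ.injective ?_,
    fun σ σ' => hρ.injective ?_⟩
  · ext h
    rw [hT', ← Q₂.P_apply, hAP, ← hT', Q₁.P_apply]
  · ext h
    rw [hT', ← Q₂.U_apply, hAU, ← hT', Q₁.U_apply]
  · ext h
    rw [hS, ← Q₂.P_apply, hXP, ← hS, Q₂.P_apply]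
  · ext h
    rw [hS, ← Q₂.U_apply, hXU, ← hS, Q₂.U_apply]
  · ext h
    refine ext_inner_left ℂ fun g => ?_
    rw [map_add, add_apply, inner_add_right, ← hL₁.inner_eq, ← hL₂.inner_eq, ← hL₂.inner_eq, hT',
      hT', hS, hS, hXin]
    ring
  · ext h
    refine ext_inner_left ℂ fun g => ?_
    rw [← hL₁.inner_eq, ← hΛ₁.inner_eq, hT', ← inner_conj_symm, hAval, inner_conj_symm]

end Transfer

end AlphaCPD

end

noncomputable section

namespace AlphaCPD

/-! ### Direct sums and the Bures distance -/

section DirectSum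

variable {B : Type*} [CStarAlgebra B]
variable {C : Type*} [CStarAlgebra C] [PartialOrder C] [StarOrderedRing C]
variable {Ω : Type*} {α : B ≃⋆ₐ[ℂ] B} {κ κ₁ κ₂ : Ω → Ω → B →L[ℂ] C}
variable {F : Type*} [NormedAddCommGroup F] [NormedSpace ℂ F] [SMul Cᵐᵒᵖ F] [CStarModule Cᵐᵒᵖ F]
variable {F₁ : Type*} [NormedAddCommGroup F₁] [NormedSpace ℂ F₁] [SMul Cᵐᵒᵖ F₁]
  [CStarModule Cᵐᵒᵖ F₁]
variable {F₂ : Type*} [NormedAddCommGroup F₂] [NormedSpace ℂ F₂] [SMul Cᵐᵒᵖ F₂]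
  [CStarModule Cᵐᵒᵖ F₂]
variable {D : SCorrespondence B C F} {i : Ω → F}
variable {D₁ : SCorrespondence B C F₁} {i₁ : Ω → F₁} {D₂ : SCorrespondence B C F₂} {i₂ : Ω → F₂}

lemma isAdjointableBilinear_id (D : SCorrespondence B C F) :
    IsAdjointableBilinear D D (ContinuousLinearMap.id ℂ F) where
  adjointable := ⟨ContinuousLinearMap.id ℂ F, fun _ _ => rfl⟩
  map_left _ _ := rfl
  map_right _ _ := rfl

lemma isAdjointableBilinear_zero (D₁ : SCorrespondence B C F₁) (D₂ : SCorrespondence B C F₂) :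
    IsAdjointableBilinear D₁ D₂ 0 where
  adjointable := ⟨0, fun x y => by
    rw [zero_apply, zero_apply, ip_zero_left, ip_zero_right]⟩
  map_left b x := by rw [zero_apply, zero_apply, map_zero]
  map_right c x := by
    rw [zero_apply, zero_apply]
    exact ext_ip C fun z => by rw [ip_op_smul_right, ip_zero_right, zero_mul]

/-- An equivariant isometry `x ↦ T x ⊕ S x` maps Kolmogorov decompositions to Kolmogorov
decompositions. -/
lemma IsKolmogorov.directSum (hi : IsKolmogorov α κ D i) {T : F →L[ℂ] F₁} {S : F →L[ℂ] F₂}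
    (hT : IsAdjointableBilinear D D₁ T) (hS : IsAdjointableBilinear D D₂ S)
    (hTU : ∀ x, T (D.U x) = D₁.U (T x)) (hSU : ∀ x, S (D.U x) = D₂.U (S x))
    (hTS : ∀ x y, ip C (T x) (T y) + ip C (S x) (S y) = ip C x y) :
    IsKolmogorov α κ (D₁.directSum D₂) (fun σ => (T (i σ), S (i σ)) : Ω → DirectSum C F₁ F₂) where
  kernel_eq σ σ' b := by
    change κ σ σ' b =
      ip C (T (i σ)) (D₁.π b (T (i σ'))) + ip C (S (i σ)) (D₂.π b (S (i σ')))
    rw [← hT.map_left, ← hS.map_left, hTS, hi.kernel_eq]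
  kernel_eq' σ σ' b := by
    change κ σ σ' b = ip C (D₁.π (α (star b)) (T (i σ))) (T (i σ')) +
      ip C (D₂.π (α (star b)) (S (i σ))) (S (i σ'))
    rw [← hT.map_left, ← hS.map_left, hTS, hi.kernel_eq']
  U_apply b σ c := by
    refine Prod.ext ?_ ?_
    · change D₁.U (MulOpposite.op c • D₁.π b (T (i σ))) =
        MulOpposite.op c • D₁.π (α b) (T (i σ))
      rw [← hT.map_left, ← hT.map_right, ← hTU, hi.U_apply, hT.map_right, hT.map_left]
    · change D₂.U (MulOpposite.op c • D₂.π b (S (i σ))) =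
        MulOpposite.op c • D₂.π (α b) (S (i σ))
      rw [← hS.map_left, ← hS.map_right, ← hSU, hi.U_apply, hS.map_right, hS.map_left]

lemma IsKolmogorov.inl (hi : IsKolmogorov α κ D₁ i₁) (D₂ : SCorrespondence B C F₂) :
    IsKolmogorov α κ (D₁.directSum D₂) (fun σ => (i₁ σ, 0) : Ω → DirectSum C F₁ F₂) :=
  hi.directSum (isAdjointableBilinear_id D₁) (isAdjointableBilinear_zero D₁ D₂) (fun _ => rfl)
    (fun x => by rw [zero_apply, zero_apply, map_zero])
    (fun x y => by rw [zero_apply, zero_apply, ip_zero_left, add_zero]; rfl)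

lemma IsKolmogorov.inr (hi : IsKolmogorov α κ D₂ i₂) (D₁ : SCorrespondence B C F₁) :
    IsKolmogorov α κ (D₁.directSum D₂) (fun σ => (0, i₂ σ) : Ω → DirectSum C F₁ F₂) :=
  hi.directSum (isAdjointableBilinear_zero D₂ D₁) (isAdjointableBilinear_id D₂)
    (fun x => by rw [zero_apply, zero_apply, map_zero]) (fun _ => rfl)
    (fun x y => by rw [zero_apply, zero_apply, ip_zero_left, zero_add]; rfl)

lemma isCommon_directSum (hi₁ : IsKolmogorov α κ₁ D₁ i₁) (hi₂ : IsKolmogorov α κ₂ D₂ i₂) :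
    IsCommon α (D₁.directSum D₂) κ₁ κ₂ :=
  ⟨⟨_, hi₁.inl D₂⟩, ⟨_, hi₂.inr D₁⟩⟩

/-- Evaluating the kernels at `1` gives `⟨jₘ(σ), jₘ(σ)⟩`, so the expression under the norm is
`⟨j₁(σ) - j₂(σ), j₁(σ) - j₂(σ)⟩`. -/
lemma norm_sub_eq_sqrt {j₁ j₂ : Ω → F} (hj₁ : IsKolmogorov α κ₁ D j₁)
    (hj₂ : IsKolmogorov α κ₂ D j₂) (σ : Ω) :
    ‖j₁ σ - j₂ σ‖ =
      √‖κ₁ σ σ 1 + κ₂ σ σ 1 - (2 : ℝ) • (realPart (ip C (j₁ σ) (j₂ σ)) : C)‖ := by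
  have h1 : κ₁ σ σ 1 + κ₂ σ σ 1 - (2 : ℝ) • (realPart (ip C (j₁ σ) (j₂ σ)) : C) =
      ip C (j₁ σ - j₂ σ) (j₁ σ - j₂ σ) := by
    rw [hj₁.kernel_eq, hj₂.kernel_eq, D.π_one_apply, D.π_one_apply, realPart_apply_coe, smul_smul,
      mul_inv_cancel₀ two_ne_zero, one_smul, star_ip, ip_sub_left, ip_sub_right, ip_sub_right]
    abel
  rw [h1, ← norm_sq_eq_norm_ip, Real.sqrt_sq (norm_nonneg _)]

variable {H : Type*} [NormedAddCommGroup H] [InnerProductSpace ℂ H] [CompleteSpace H]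
variable {ρ : C →⋆ₐ[ℂ] (H →L[ℂ] H)}

lemma MAt_subset_NOnAt_directSum (hρ : ActsAsVonNeumannAlgebra ρ)
    (hF₁ : IsVonNeumannModule ρ F₁) (hF₂ : IsVonNeumannModule ρ F₂)
    (hi₁ : IsKolmogorov α κ₁ D₁ i₁) (hi₂ : IsKolmogorov α κ₂ D₂ i₂) (σ : Ω) :
    MAt D₁ i₁ D₂ i₂ σ ⊆ NOnAt α (D₁.directSum D₂) κ₁ κ₂ σ := by
  rintro m ⟨T, hT, hTn, rfl⟩
  -- Transfer from the decompositions to themselves: the gain is equivariance under the unitaries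
  -- and the defect `S`.
  obtain ⟨T', S, hT', -, hT'U, hS, hSU, hsum, hval⟩ :=
    exists_transfer hρ hF₁ hF₂ hi₁ hi₂ hi₁ hi₂ hT hTn
  refine ⟨_, hi₁.inl D₂, _, hi₂.directSum hT' hS hT'U hSU hsum, ?_⟩
  rw [← hval]
  change _ = ip C (i₁ σ) (T' (i₂ σ)) + ip C 0 (S (i₂ σ))
  rw [ip_zero_left, add_zero]

/-- Transfer of the identity map of `F`, regarded as carrying both decompositions; `F` itself need
not be a von Neumann module. -/
lemma NOnAt_subset_MAt (hρ : ActsAsVonNeumannAlgebra ρ)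
    (hF₁ : IsVonNeumannModule ρ F₁) (hF₂ : IsVonNeumannModule ρ F₂)
    (hi₁ : IsKolmogorov α κ₁ D₁ i₁) (hi₂ : IsKolmogorov α κ₂ D₂ i₂)
    (D : SCorrespondence B C F) (σ : Ω) :
    NOnAt α D κ₁ κ₂ σ ⊆ MAt D₁ i₁ D₂ i₂ σ := by
  rintro m ⟨j₁, hj₁, j₂, hj₂, rfl⟩
  obtain ⟨T', -, hT', hT'n, -, -, -, -, hval⟩ :=
    exists_transfer hρ hF₁ hF₂ hi₁ hi₂ hj₁ hj₂ (isAdjointableBilinear_id D)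
      ContinuousLinearMap.norm_id_le
  exact ⟨T', hT', hT'n, (hval σ σ).symm⟩

lemma MAt_subset_MAt (hρ : ActsAsVonNeumannAlgebra ρ)
    (hF₁ : IsVonNeumannModule ρ F₁) (hF₂ : IsVonNeumannModule ρ F₂)
    (hi₁ : IsKolmogorov α κ₁ D₁ i₁) (hi₂ : IsKolmogorov α κ₂ D₂ i₂)
    {E₁ : Type*} [NormedAddCommGroup E₁] [NormedSpace ℂ E₁] [SMul Cᵐᵒᵖ E₁] [CStarModule Cᵐᵒᵖ E₁]
    {E₂ : Type*} [NormedAddCommGroup E₂] [NormedSpace ℂ E₂] [SMul Cᵐᵒᵖ E₂] [CStarModule Cᵐᵒᵖ E₂]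
    {G₁ : SCorrespondence B C E₁} {j₁ : Ω → E₁} {G₂ : SCorrespondence B C E₂} {j₂ : Ω → E₂}
    (hj₁ : IsKolmogorov α κ₁ G₁ j₁) (hj₂ : IsKolmogorov α κ₂ G₂ j₂) (σ : Ω) :
    MAt G₁ j₁ G₂ j₂ σ ⊆ MAt D₁ i₁ D₂ i₂ σ := by
  rintro m ⟨T, hT, hTn, rfl⟩
  obtain ⟨T', -, hT', hT'n, -, -, -, -, hval⟩ :=
    exists_transfer hρ hF₁ hF₂ hi₁ hi₂ hj₁ hj₂ hT hTn
  exact ⟨T', hT', hT'n, (hval σ σ).symm⟩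

end DirectSum

end AlphaCPD

end

/-! ### The proposition. -/

theorem mainTheorem3
    {B : Type u} [CStarAlgebra B]
    {C : Type v} [CStarAlgebra C] [PartialOrder C] [StarOrderedRing C]
    {H : Type z} [NormedAddCommGroup H] [InnerProductSpace ℂ H] [CompleteSpace H]
    (ρ : C →⋆ₐ[ℂ] (H →L[ℂ] H)) (hρ : ActsAsVonNeumannAlgebra ρ)
    {Ω : Type t} (α : B ≃⋆ₐ[ℂ] B) (κ₁ κ₂ : Ω → Ω → B →L[ℂ] C)
    (hκ₁ : IsAlphaCPD α κ₁) (hκ₂ : IsAlphaCPD α κ₂)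
    -- Kolmogorov decompositions `(F₁, U₁, i₁)` of `κ₁` and `(F₂, U₂, i₂)` of `κ₂`
    {F₁ : Type w} [NormedAddCommGroup F₁] [NormedSpace ℂ F₁] [SMul Cᵐᵒᵖ F₁]
    [CStarModule Cᵐᵒᵖ F₁] [CompleteSpace F₁] (hF₁ : IsVonNeumannModule ρ F₁)
    (D₁ : SCorrespondence B C F₁) (i₁ : Ω → F₁) (hi₁ : IsKolmogorov α κ₁ D₁ i₁)
    {F₂ : Type w} [NormedAddCommGroup F₂] [NormedSpace ℂ F₂] [SMul Cᵐᵒᵖ F₂]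
    [CStarModule Cᵐᵒᵖ F₂] [CompleteSpace F₂] (hF₂ : IsVonNeumannModule ρ F₂)
    (D₂ : SCorrespondence B C F₂) (i₂ : Ω → F₂) (hi₂ : IsKolmogorov α κ₂ D₂ i₂) :
    -- (i) independence of the decompositions
    (∀ {G₁ : Type w'} [NormedAddCommGroup G₁] [NormedSpace ℂ G₁] [SMul Cᵐᵒᵖ G₁]
        [CStarModule Cᵐᵒᵖ G₁] [CompleteSpace G₁] (_ : IsVonNeumannModule ρ G₁)
        (D₁' : SCorrespondence B C G₁) (i₁' : Ω → G₁) (_ : IsKolmogorov α κ₁ D₁' i₁')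
        {G₂ : Type w'} [NormedAddCommGroup G₂] [NormedSpace ℂ G₂] [SMul Cᵐᵒᵖ G₂]
        [CStarModule Cᵐᵒᵖ G₂] [CompleteSpace G₂] (_ : IsVonNeumannModule ρ G₂)
        (D₂' : SCorrespondence B C G₂) (i₂' : Ω → G₂) (_ : IsKolmogorov α κ₂ D₂' i₂'),
        (∀ σ, MAt D₁' i₁' D₂' i₂' σ = MAt D₁ i₁ D₂ i₂ σ) ∧
          M D₁' i₁' D₂' i₂' = M D₁ i₁ D₂ i₂) ∧
    -- (ii) the three sets agree, also separately at each point of `Ω`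
    (∀ σ, MAt D₁ i₁ D₂ i₂ σ = NAt.{u, v, w, t} α κ₁ κ₂ σ ∧
        MAt D₁ i₁ D₂ i₂ σ = NOnAt α (D₁.directSum D₂) κ₁ κ₂ σ) ∧
    (M D₁ i₁ D₂ i₂ = N.{u, v, w, t} α κ₁ κ₂ ∧
        M D₁ i₁ D₂ i₂ = NOn α (D₁.directSum D₂) κ₁ κ₂) ∧
    -- (iii) the formula for the Bures distance
    bures.{u, v, w, t} α κ₁ κ₂ =
      sInf {r : ℝ | ∃ σ : Ω, ∃ m ∈ MAt D₁ i₁ D₂ i₂ σ,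
        r = Real.sqrt ‖κ₁ σ σ 1 + κ₂ σ σ 1 - (2 : ℝ) • (realPart m : C)‖} := by
  have hMNOn := fun σ => Set.Subset.antisymm
    (MAt_subset_NOnAt_directSum hρ hF₁ hF₂ hi₁ hi₂ σ)
    (NOnAt_subset_MAt hρ hF₁ hF₂ hi₁ hi₂ (D₁.directSum D₂) σ)
  have hcommon := isCommon_directSum hi₁ hi₂
  have hMN : ∀ σ, MAt D₁ i₁ D₂ i₂ σ = NAt.{u, v, w, t} α κ₁ κ₂ σ := by
    intro σ
    ext m
    constructor
    · intro hm
      exact ⟨DirectSum C F₁ F₂, inferInstance, inferInstance, inferInstance, inferInstance,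
        inferInstance, D₁.directSum D₂, hcommon, hMNOn σ ▸ hm⟩
    · rintro ⟨F, _, _, _, _, _, D, -, hm⟩
      exact NOnAt_subset_MAt hρ hF₁ hF₂ hi₁ hi₂ D σ hm
  refine ⟨?_, fun σ => ⟨hMN σ, hMNOn σ⟩, ⟨?_, Set.iUnion_congr hMNOn⟩, ?_⟩
  · intro G₁ _ _ _ _ _ hG₁ D₁' i₁' hi₁' G₂ _ _ _ _ _ hG₂ D₂' i₂' hi₂'
    have h : ∀ σ, MAt D₁' i₁' D₂' i₂' σ = MAt D₁ i₁ D₂ i₂ σ := fun σ =>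
      Set.Subset.antisymm (MAt_subset_MAt hρ hF₁ hF₂ hi₁ hi₂ hi₁' hi₂' σ)
        (MAt_subset_MAt hρ hG₁ hG₂ hi₁' hi₂' hi₁ hi₂ σ)
    exact ⟨h, Set.iUnion_congr h⟩
  · ext m
    constructor
    · intro hm
      obtain ⟨σ, hσ⟩ := Set.mem_iUnion.mp hm
      rw [hMN] at hσ
      obtain ⟨F, _, _, _, _, _, D, hD, hmD⟩ := hσ
      exact ⟨F, _, _, _, _, inferInstance, D, hD, Set.mem_iUnion.mpr ⟨σ, hmD⟩⟩
    · rintro ⟨F, _, _, _, _, _, D, -, hm⟩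
      obtain ⟨σ, hσ⟩ := Set.mem_iUnion.mp hm
      exact Set.mem_iUnion.mpr ⟨σ, NOnAt_subset_MAt hρ hF₁ hF₂ hi₁ hi₂ D σ hσ⟩
  · set R : Set ℝ := {r : ℝ | ∃ σ : Ω, ∃ m ∈ MAt D₁ i₁ D₂ i₂ σ,
        r = Real.sqrt ‖κ₁ σ σ 1 + κ₂ σ σ 1 - (2 : ℝ) • (realPart m : C)‖} with hR
    have hbdd : BddBelow R := ⟨0, by rintro r ⟨σ, m, -, rfl⟩; exact Real.sqrt_nonneg _⟩
    have hsum : buresOn α (D₁.directSum D₂) κ₁ κ₂ = sInf R := by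
      rw [buresOn]
      congr 1
      ext r
      constructor
      · rintro ⟨j₁, hj₁, j₂, hj₂, σ, rfl⟩
        refine ⟨σ, ip C (j₁ σ) (j₂ σ), ?_, norm_sub_eq_sqrt hj₁ hj₂ σ⟩
        rw [hMNOn]
        exact ⟨j₁, hj₁, j₂, hj₂, rfl⟩
      · rintro ⟨σ, m, hm, rfl⟩
        rw [hMNOn] at hm
        obtain ⟨j₁, hj₁, j₂, hj₂, rfl⟩ := hm
        exact ⟨j₁, hj₁, j₂, hj₂, σ, (norm_sub_eq_sqrt hj₁ hj₂ σ).symm⟩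
    -- The infimum over all common S-correspondences is attained at `F₁ ⊕ F₂`.
    refine IsLeast.csInf_eq ⟨?_, ?_⟩
    · exact ⟨DirectSum C F₁ F₂, inferInstance, inferInstance, inferInstance, inferInstance,
        inferInstance, D₁.directSum D₂, hcommon, hsum.symm⟩
    · rintro _ ⟨F, _, _, _, _, _, D, ⟨⟨j₁, hj₁⟩, ⟨j₂, hj₂⟩⟩, rfl⟩
      rcases isEmpty_or_nonempty Ω with hΩ | ⟨⟨σ₀⟩⟩
      -- Over an empty `Ω` the real infimum of the empty set is `0` by convention, so both sides are
      -- comparable.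
      · have h1 : R = ∅ := Set.eq_empty_of_forall_notMem fun r ⟨σ, _⟩ => hΩ.elim σ
        rw [h1, Real.sInf_empty]
        exact Real.sInf_nonneg (by rintro r ⟨_, _, _, _, σ, rfl⟩; exact norm_nonneg _)
      · refine le_csInf ⟨_, j₁, hj₁, j₂, hj₂, σ₀, rfl⟩ ?_
        rintro _ ⟨k₁, hk₁, k₂, hk₂, σ, rfl⟩
        exact csInf_le hbdd ⟨σ, ip C (k₁ σ) (k₂ σ),
          NOnAt_subset_MAt hρ hF₁ hF₂ hi₁ hi₂ D σ ⟨k₁, hk₁, k₂, hk₂, rfl⟩,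
          norm_sub_eq_sqrt hk₁ hk₂ σ⟩
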